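/- Let $0<\omega<\pi$ and let $\Pi_0=(-\infty,0)\times(0,1)\subset\mathbb{R}^2$. Let $A_\pm=(p_\pm,1)$ with $p_\pm<0$, $p_+\neq p_-$, be two distinct points of the upper side of $\Pi_0$. Let $\gamma_\pm:\Pi_0\to\mathbb{C}$ be outgoing solutions of $$\Delta\gamma_\pm+\omega^2\gamma_\pm=0\ \text{ in }\Pi_0,\qquad \partial_\nu\gamma_\pm=\delta_{A_\pm}\ \text{ on }\partial\Pi_0 .$$ This means that: $\gamma_\pm$ is continuous in $\Pi_0$ and integrable on $\{(x,y)\in\Pi_0 : x>-R\}$ for every $R$; one has $$\int_{\Pi_0}\gamma_\pm\,(\Delta\varphi+\omega^2\varphi)\,dx\,dy=-\varphi(A_\pm)$$ for every $\varphi\in C_c^\infty(\mathbb{R}^2)$ with $\partial_\nu\varphi=0$ on $\partial\Pi_0$; and there is $s\in\mathbb{C}$ such that $\gamma_\pm-s\,e^{-i\omega x}$ is exponentially decaying, that is, bounded by $Ce^{\alpha x}$ for some $\alpha>0$, $C$ and all $(x,y)\in\Pi_0$ with $-x$ large enough. Then the following holds. 1. $\gamma_+$ has a limit at $A_-$ and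 $\gamma_-$ has a limit at $A_+$ (from within $\Pi_0$), these limits are equal, and their common value $\tilde\Gamma=\gamma_+(A_-)=\gamma_-(A_+)$ satisfies $\Im(\omega\tilde\Gamma)=\cos(\omega p_+)\cos(\omega p_-)$. 2. With $r_\pm=((x-p_\pm)^2+(y-1)^2)^{1/2}$, there are constants $\Gamma_\pm\in\mathbb{C}$ such that $$\gamma_\pm(x,y)=\frac1\pi\ln\frac1{r_\pm}+\Gamma_\pm+O(r_\pm)\quad\text{as } r_\pm\to0^+ \text{ in }\Pi_0,$$ and they satisfy $\Im(\omega\Gamma_\pm)=\cos^2(\omega p_\pm)$. 3. The number $s$ for which $\gamma_\pm-s\,e^{-i\omega x}$ is exponentially decaying is unique and equals $s_\pm=i\cos(\omega p_\pm)/\omega$, and the function $\gamma_\pm-s_\pm e^{-i\omega x}$ is real-valued in $\Pi_0$. -/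

import Mathlib

open Filter Topology MeasureTheory

namespace HalfStrip

/-- The half-strip `(-∞, 0) × (0, 1)`. -/
def strip : Set (ℝ × ℝ) := Set.Iio 0 ×ˢ Set.Ioo 0 1

/-- The distance `((x - p)² + (y - 1)²)^(1/2)` from `z = (x, y)` to the boundary point `(p, 1)`. -/
noncomputable def dist₁ (p : ℝ) (z : ℝ × ℝ) : ℝ := √((z.1 - p) ^ 2 + (z.2 - 1) ^ 2)

/-- The Laplacian `∂ₓ²φ + ∂ᵧ²φ` of a function of two real variables. -/
noncomputable def laplacian (φ : ℝ × ℝ → ℝ) (z : ℝ × ℝ) : ℝ :=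
  iteratedDeriv 2 (fun x => φ (x, z.2)) z.1 + iteratedDeriv 2 (fun y => φ (z.1, y)) z.2

/-- Test functions: smooth and compactly supported on the closed half-strip (as restrictions of
such functions on the plane), with vanishing normal derivative on its boundary. -/
structure IsNeumannTest (φ : ℝ × ℝ → ℝ) : Prop where
  smooth : ContDiff ℝ ((⊤ : ℕ∞) : WithTop ℕ∞) φ
  compact : HasCompactSupport φ
  bottom : ∀ x ≤ 0, deriv (fun y => φ (x, y)) 0 = 0
  top : ∀ x ≤ 0, deriv (fun y => φ (x, y)) 1 = 0
  side : ∀ y ∈ Set.Icc (0 : ℝ) 1, deriv (fun x => φ (x, y)) 0 = 0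

/-- `γ` is a solution of `Δγ + ω²γ = 0` in the half-strip, `∂_ν γ = δ_A` on its boundary, where
`A = (p, 1)`. The problem is understood in the distributional sense (Green's formula against the
test functions above); `γ` is locally integrable up to the boundary, and is the representative of
its class that is continuous in the half-strip. Values outside the half-strip play no role. -/
structure IsPointSourceSolution (ω p : ℝ) (γ : ℝ × ℝ → ℂ) : Prop where
  continuousOn : ContinuousOn γ strip
  integrableOn : ∀ R : ℝ, IntegrableOn γ (strip ∩ {z | -R < z.1})
  weak : ∀ φ : ℝ × ℝ → ℝ, IsNeumannTest φ →
    ∫ z in strip, γ z * ((laplacian φ z + ω ^ 2 * φ z : ℝ) : ℂ) = -(φ (p, 1) : ℂ)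

/-- The outgoing plane mode `e^{-iωx}`. -/
noncomputable def outgoingMode (ω : ℝ) (z : ℝ × ℝ) : ℂ :=
  Complex.exp (-(Complex.I * ω * z.1))

/-- `f` decays exponentially as `x → -∞` in the half-strip, uniformly in `y`. -/
def ExpDecay (f : ℝ × ℝ → ℂ) : Prop :=
  ∃ α > 0, ∃ C x₀ : ℝ, ∀ z ∈ strip, z.1 ≤ x₀ → ‖f z‖ ≤ C * Real.exp (α * z.1)

/-- `γ` is outgoing with amplitude `s`: `γ = s e^{-iωx} +` an exponentially decaying remainder. -/
def HasAmplitude (ω : ℝ) (γ : ℝ × ℝ → ℂ) (s : ℂ) : Prop :=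
  ExpDecay fun z => γ z - s * outgoingMode ω z

/-- `γ` is an outgoing solution of the Neumann problem with Dirac source at `(p, 1)`. -/
structure IsOutgoingSolution (ω p : ℝ) (γ : ℝ × ℝ → ℂ) : Prop
    extends IsPointSourceSolution ω p γ where
  outgoing : ∃ s : ℂ, HasAmplitude ω γ s

/-- `Γ` is the constant term of `γ` at its singularity `(p, 1)`:
`γ = (1/π) ln (1/r) + Γ + O(r)` as `r → 0⁺`, `r` the distance to `(p, 1)`. -/
def HasLogConstant (p : ℝ) (γ : ℝ × ℝ → ℂ) (Γ : ℂ) : Prop :=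
  Asymptotics.IsBigO (𝓝[strip] (p, 1))
    (fun z => γ z - (((1 / Real.pi * Real.log (1 / dist₁ p z) : ℝ) : ℂ) + Γ)) (dist₁ p)

/-- `Γ` is the constant behaviour of `γ` at the boundary point `(q, 1)`, i.e. the value there of
the continuous extension of `γ`. -/
def HasBoundaryValue (q : ℝ) (γ : ℝ × ℝ → ℂ) (Γ : ℂ) : Prop :=
  Tendsto γ (𝓝[strip] (q, 1)) (𝓝 Γ)

end HalfStrip

/-! The proof separates variables and identifies the solution with an explicit function. Tested
against products `ψ(x) cos(nπ(1 - y))`, the weak formulation says that each cosine coefficient `c`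
of `γ` satisfies `k²c - c'' = δ_p` on `(-∞, 0)` with the Neumann condition at `0`, where `k² = (nπ)²
- ω²`. Since `0 < ω < π`, only `n = 0` propagates (`k = -iω`); for `n ≥ 1` one takes `k > 0`. The
radiation condition then leaves only the outgoing Green function: this is `ae_eq_modeGreen`, proved
by duality, with a cutoff whose contribution vanishes at infinity. Cosine coefficients determine an
integrable function on `(0, 1)` and `γ` is continuous, so `γ = green` in the strip
(`IsPointSourceSolution.eqOn_green`).

The function `green` is `profile` plus its mirror image in `x = 0`. In `profile`, the evanescent
terms `e^{-κt}/κ` are compared with their zero-frequency counterparts `e^{-Kt}/K`, `K = nπ`. The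
latter sum to `-(1/π) log |1 - e^{π(-t + iu)}|`, which carries the logarithmic singularity
(`hasSum_logPart`); the differences sum to a function that is Lipschitz up to the pole
(`abs_corr_sub_le`), whence the remainder `O(r)`.

All evanescent terms are real, so the imaginary part comes from the propagating mode alone and
equals `cos(ωp) cos(ωx) / ω` (`green_im`). This yields the imaginary parts of all the constants and
the reality of `γ` minus its plane wave. The two limits agree because `green` is symmetric in the
pole and the point on the upper side. -/

namespace HalfStrip

/-! ### Completeness and orthogonality of the cosines on `(0, 1)` -/

open Set Polynomial

/-- The Neumann modes of the cross-section `(0, 1)`, normalized to be `1` at `y = 1`. -/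
noncomputable def crossMode (n : ℕ) (y : ℝ) : ℝ := Real.cos (n * Real.pi * (1 - y))

lemma continuous_crossMode (n : ℕ) : Continuous (crossMode n) := by
  unfold crossMode; fun_prop

lemma abs_crossMode_le_one (n : ℕ) (y : ℝ) : |crossMode n y| ≤ 1 := Real.abs_cos_le_one _

lemma integrable_smul_of_bounded {α : Type*} [MeasurableSpace α] {μ : Measure α} {g : α → ℂ}
    (hg : Integrable g μ) {h : α → ℝ} (hh : AEStronglyMeasurable h μ) (C : ℝ)
    (hC : ∀ y, |h y| ≤ C) : Integrable (fun y => h y • g y) μ :=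
  hg.bdd_smul C hh (Eventually.of_forall hC)

/-- By the identity `2 cos a cos b = cos(a - b) + cos(a + b)`, multiplication by `crossMode 1`
preserves the span of the modes. The induction on the degree needs all `n` at once, since it shifts
the index both ways. -/
lemma integral_polynomial_smul_eq_zero {g : ℝ → ℂ} (hg : IntegrableOn g (Ioo 0 1))
    (h : ∀ n : ℕ, ∫ y in Ioo (0 : ℝ) 1, crossMode n y • g y = 0) (P : ℝ[X]) :
    ∀ n : ℕ, ∫ y in Ioo (0 : ℝ) 1, (P.eval (crossMode 1 y) * crossMode n y) • g y = 0 := by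
  have hint : ∀ (Q : ℝ[X]) (n : ℕ), IntegrableOn
      (fun y => (Q.eval (crossMode 1 y) * crossMode n y) • g y) (Ioo 0 1) := by
    intro Q n
    have hc : Continuous fun y => Q.eval (crossMode 1 y) :=
      Q.continuous.comp (continuous_crossMode 1)
    obtain ⟨C, hC⟩ := isCompact_Icc.exists_bound_of_continuousOn
      (f := fun v : ℝ => Q.eval v) (s := Icc (-1) 1) Q.continuous.continuousOn
    refine integrable_smul_of_bounded hg
      (hc.mul (continuous_crossMode n)).aestronglyMeasurable C fun y => ?_
    have h1 := hC (crossMode 1 y) (abs_le.mp (abs_crossMode_le_one 1 y))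
    rw [abs_mul]
    exact (mul_le_of_le_one_right (abs_nonneg _) (abs_crossMode_le_one n y)).trans h1
  induction P using Polynomial.induction_on' with
  | add p q hp hq =>
    intro n
    have := integral_add (hint p n) (hint q n)
    rw [hp n, hq n, add_zero] at this
    rw [← this]
    congr 1; ext y
    rw [eval_add, add_mul, add_smul]
  | monomial m a =>
    induction m with
    | zero =>
      intro n
      have : ∀ y, (((monomial 0 a).eval (crossMode 1 y) * crossMode n y) • g y)
          = a • (crossMode n y • g y) := fun y => by simp [mul_assoc]
      simp_rw [this, integral_smul, h n, smul_zero]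
    | succ m ih =>
      intro n
      rcases n with _ | n
      · rw [← ih 1]
        congr 1; ext y
        simp only [eval_monomial, crossMode, Nat.cast_zero, zero_mul, Real.cos_zero, mul_one]
        rw [pow_succ, ← mul_assoc]
      · have h1 := integral_add ((hint (monomial m a) n).smul (1 / 2 : ℝ))
          ((hint (monomial m a) (n + 2)).smul (1 / 2 : ℝ))
        simp only [Pi.smul_apply, integral_smul, ih, smul_zero, add_zero] at h1
        rw [← h1]
        congr 1; ext y
        rw [smul_smul, smul_smul, ← add_smul]
        congr 1
        have hcos : crossMode 1 y * crossMode (n + 1) y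
            = (crossMode n y + crossMode (n + 2) y) / 2 := by
          simp only [crossMode]
          have e1 : ((n : ℕ) : ℝ) * Real.pi * (1 - y) = ((n + 1 : ℕ) : ℝ) * Real.pi * (1 - y)
              - ((1 : ℕ) : ℝ) * Real.pi * (1 - y) := by push_cast; ring
          have e2 : ((n + 2 : ℕ) : ℝ) * Real.pi * (1 - y) = ((n + 1 : ℕ) : ℝ) * Real.pi * (1 - y)
              + ((1 : ℕ) : ℝ) * Real.pi * (1 - y) := by push_cast; ring
          rw [e1, e2, Real.cos_sub, Real.cos_add]; ring
        simp only [eval_monomial]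
        rw [pow_succ]
        linear_combination (a * crossMode 1 y ^ m) * hcos

/-- On `(0, 1)` one recovers `y` from `crossMode 1 y = cos(π(1 - y))` by `arccos`, so a continuous
function of `y` is a continuous function of `crossMode 1 y` and Weierstrass approximation applies.
-/
lemma integral_continuous_smul_eq_zero {g : ℝ → ℂ} (hg : IntegrableOn g (Ioo 0 1))
    (h : ∀ n : ℕ, ∫ y in Ioo (0 : ℝ) 1, crossMode n y • g y = 0) {f : ℝ → ℝ}
    (hf : Continuous f) : ∫ y in Ioo (0 : ℝ) 1, f y • g y = 0 := by
  obtain ⟨C, hC⟩ := isCompact_Icc.exists_bound_of_continuousOn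
      (f := f) (s := Icc 0 1) hf.continuousOn
  have hfi : IntegrableOn (fun y => f y • g y) (Ioo 0 1) := by
    refine hg.bdd_smul C hf.aestronglyMeasurable ?_
    filter_upwards [ae_restrict_mem measurableSet_Ioo] with y hy
    exact hC y (Ioo_subset_Icc_self hy)
  set N := ∫ y in Ioo (0 : ℝ) 1, ‖g y‖ with hN
  have key : ∀ ε > 0, ‖∫ y in Ioo (0 : ℝ) 1, f y • g y‖ ≤ ε * N := by
    intro ε hε
    obtain ⟨P, hP⟩ := exists_polynomial_near_of_continuousOn (-1) 1
      (fun v => f (1 - Real.arccos v / Real.pi))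
      (hf.comp (continuous_const.sub (Real.continuous_arccos.div_const _))).continuousOn ε hε
    have hP0 := integral_polynomial_smul_eq_zero hg h P 0
    have hcm0 : ∀ y, crossMode 0 y = 1 := fun y => by simp [crossMode]
    simp only [hcm0, mul_one] at hP0
    have hPi : IntegrableOn (fun y => P.eval (crossMode 1 y) • g y) (Ioo 0 1) := by
      obtain ⟨C, hC⟩ := isCompact_Icc.exists_bound_of_continuousOn
        (f := fun v : ℝ => P.eval v) (s := Icc (-1) 1) P.continuous.continuousOn
      exact integrable_smul_of_bounded hg
        (P.continuous.comp (continuous_crossMode 1)).aestronglyMeasurable C fun y =>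
          hC (crossMode 1 y) (abs_le.mp (abs_crossMode_le_one 1 y))
    have hsub := integral_sub hfi hPi
    rw [hP0, sub_zero] at hsub
    rw [← hsub, hN, ← integral_const_mul]
    refine norm_integral_le_of_norm_le (hg.norm.const_mul ε) ?_
    filter_upwards [ae_restrict_mem measurableSet_Ioo] with y hy
    rw [← sub_smul, norm_smul]
    refine mul_le_mul_of_nonneg_right ?_ (norm_nonneg _)
    have h1 := hP (crossMode 1 y) (abs_le.mp (abs_crossMode_le_one 1 y))
    have harc : Real.arccos (crossMode 1 y) = Real.pi * (1 - y) := by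
      simp only [crossMode, Nat.cast_one, one_mul]
      exact Real.arccos_cos (mul_nonneg Real.pi_pos.le (by linarith [hy.2]))
        (mul_le_of_le_one_right Real.pi_pos.le (by linarith [hy.1]))
    rw [harc, mul_div_cancel_left₀ _ Real.pi_ne_zero, sub_sub_cancel] at h1
    rw [Real.norm_eq_abs, abs_sub_comm]
    exact h1.le
  have hN0 : 0 ≤ N := integral_nonneg fun y => norm_nonneg _
  refine norm_le_zero_iff.mp (le_of_forall_pos_le_add fun δ hδ => ?_)
  refine (key (δ / (N + 1)) (by positivity)).trans ?_
  rw [zero_add, div_mul_eq_mul_div, div_le_iff₀ (by positivity)]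
  nlinarith

/-- An integrable function on `(0, 1)` is determined by its cosine coefficients. -/
theorem ae_eq_zero_of_integral_crossMode_smul_eq_zero {g : ℝ → ℂ} (hg : IntegrableOn g (Ioo 0 1))
    (h : ∀ n : ℕ, ∫ y in Ioo (0 : ℝ) 1, crossMode n y • g y = 0) :
    ∀ᵐ y ∂volume.restrict (Ioo (0 : ℝ) 1), g y = 0 :=
  ae_eq_zero_of_integral_contDiff_smul_eq_zero hg.locallyIntegrable fun _ hf _ =>
    integral_continuous_smul_eq_zero hg h hf.continuous

lemma integral_cos_intCast_mul_pi (m : ℤ) (hm : m ≠ 0) :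
    ∫ y in (0 : ℝ)..1, Real.cos (m * Real.pi * (1 - y)) = 0 := by
  rw [intervalIntegral.integral_comp_sub_left (fun y => Real.cos (m * Real.pi * y)) 1]
  have hm' : (m : ℝ) * Real.pi ≠ 0 := mul_ne_zero (by exact_mod_cast hm) Real.pi_ne_zero
  rw [intervalIntegral.integral_comp_mul_left _ hm', integral_cos]
  simp [Real.sin_int_mul_pi]

/-- Orthogonality of the modes of the cross-section. -/
lemma integral_crossMode_mul_crossMode (m n : ℕ) :
    ∫ y in Ioo (0 : ℝ) 1, crossMode m y * crossMode n y
      = if m = n then (if n = 0 then 1 else 1 / 2) else 0 := by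
  rw [← integral_Ioc_eq_integral_Ioo, ← intervalIntegral.integral_of_le zero_le_one]
  have hsplit : ∀ y, crossMode m y * crossMode n y
      = (1 / 2) * Real.cos (((m - n : ℤ) : ℝ) * Real.pi * (1 - y))
        + (1 / 2) * Real.cos (((m + n : ℤ) : ℝ) * Real.pi * (1 - y)) := by
    intro y
    simp only [crossMode]
    have e1 : (((m : ℤ) - n : ℤ) : ℝ) * Real.pi * (1 - y) = m * Real.pi * (1 - y)
      - n * Real.pi * (1 - y) := by push_cast; ring
    have e2 : (((m : ℤ) + n : ℤ) : ℝ) * Real.pi * (1 - y) = m * Real.pi * (1 - y)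
      + n * Real.pi * (1 - y) := by push_cast; ring
    rw [e1, e2, Real.cos_sub, Real.cos_add]; ring
  simp_rw [hsplit]
  rw [intervalIntegral.integral_add (Continuous.intervalIntegrable (by fun_prop) _ _)
    (Continuous.intervalIntegrable (by fun_prop) _ _), intervalIntegral.integral_const_mul,
    intervalIntegral.integral_const_mul]
  by_cases hmn : m = n
  · subst hmn
    by_cases hm : m = 0
    · subst hm; norm_num
    · rw [integral_cos_intCast_mul_pi (m + m : ℤ) (by omega)]
      simp [hm]
  · rw [integral_cos_intCast_mul_pi (m + n : ℤ) (by omega),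
      integral_cos_intCast_mul_pi (m - n : ℤ) (by omega)]
    simp [hmn]

end HalfStrip

namespace HalfStrip

/-! ### The outgoing problem on the half-line -/

open Set

/-- The outgoing Green function with pole `p` of `k² - d²/dx²` on the half-line `(-∞, 0)`
with the Neumann condition at `0`. -/
noncomputable def modeGreen (k : ℂ) (p x : ℝ) : ℂ :=
  (Complex.exp (-k * |x - p|) + Complex.exp (-k * |x + p|)) / (2 * k)

lemma continuous_modeGreen (k : ℂ) (p : ℝ) : Continuous (modeGreen k p) := by
  unfold modeGreen; fun_prop

/-- Left of the pole, both the source and its image contribute multiples of `e^{kx}`; the amplitude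
is read off here. -/
lemma modeGreen_of_le {k : ℂ} {p x : ℝ} (hp : p < 0) (hx : x ≤ p) :
    modeGreen k p x = Complex.cosh (k * p) * Complex.exp (k * x) / k := by
  rw [modeGreen, abs_of_nonpos (by linarith), abs_of_neg (by linarith), Complex.cosh]
  have e1 : -k * ((-(x - p) : ℝ) : ℂ) = k * x + -(k * p) := by push_cast; ring
  have e2 : -k * ((-(x + p) : ℝ) : ℂ) = k * x + k * p := by push_cast; ring
  rw [e1, e2, Complex.exp_add, Complex.exp_add]
  ring

lemma modeGreen_of_ge {k : ℂ} {p x : ℝ} (hx0 : x ≤ 0) (hp : p < 0) (hx : p ≤ x) :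
    modeGreen k p x = Complex.exp (k * p) * Complex.cosh (k * x) / k := by
  rw [modeGreen, abs_of_nonneg (by linarith), abs_of_neg (by linarith), Complex.cosh]
  have e1 : -k * ((x - p : ℝ) : ℂ) = k * p + -(k * x) := by push_cast; ring
  have e2 : -k * ((-(x + p) : ℝ) : ℂ) = k * p + k * x := by push_cast; ring
  rw [e1, e2, Complex.exp_add, Complex.exp_add]
  ring

lemma hasDerivAt_exp_mul_ofReal (k : ℂ) (x : ℝ) :
    HasDerivAt (fun t : ℝ => Complex.exp (k * t)) (k * Complex.exp (k * x)) x := by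
  have h := ((Complex.ofRealCLM.hasDerivAt (x := x)).const_mul k).cexp
  simpa [mul_comm] using h

lemma hasDerivAt_cosh_mul_ofReal (k : ℂ) (x : ℝ) :
    HasDerivAt (fun t : ℝ => Complex.cosh (k * t)) (k * Complex.sinh (k * x)) x := by
  have h := (Complex.hasDerivAt_cosh (k * x)).comp x
    ((Complex.ofRealCLM.hasDerivAt (x := x)).const_mul k)
  simpa [mul_comm, Function.comp_def] using h

lemma hasDerivAt_sinh_mul_ofReal (k : ℂ) (x : ℝ) :
    HasDerivAt (fun t : ℝ => Complex.sinh (k * t)) (k * Complex.cosh (k * x)) x := by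
  have h := (Complex.hasDerivAt_sinh (k * x)).comp x
    ((Complex.ofRealCLM.hasDerivAt (x := x)).const_mul k)
  simpa [mul_comm, Function.comp_def] using h

lemma contDiff_integral {h : ℝ → ℂ} (hh : ContDiff ℝ ((⊤ : ℕ∞) : WithTop ℕ∞) h) (a : ℝ) :
    ContDiff ℝ ((⊤ : ℕ∞) : WithTop ℕ∞) fun x => ∫ t in a..x, h t := by
  have hd : ∀ x, HasDerivAt (fun x => ∫ t in a..x, h t) (h x) x := fun x =>
    intervalIntegral.integral_hasDerivAt_right (hh.continuous.intervalIntegrable _ _)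
      (hh.continuous.stronglyMeasurableAtFilter _ _) hh.continuous.continuousAt
  rw [contDiff_infty_iff_deriv]
  refine ⟨fun x => (hd x).differentiableAt, ?_⟩
  rwa [show deriv (fun x => ∫ t in a..x, h t) = h from funext fun x => (hd x).deriv]

/-- The outgoing solution of the Neumann problem for `d²ψ/dx² - k²ψ = f` on the half-line. -/
lemma exists_outgoing_potential {k : ℂ} (hk : k ≠ 0) {p : ℝ} (hp : p < 0) {f : ℝ → ℝ}
    (hf : ContDiff ℝ ((⊤ : ℕ∞) : WithTop ℕ∞) f) (hfc : HasCompactSupport f) :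
    ∃ (ψ ψ' : ℝ → ℂ) (C : ℂ) (a : ℝ), a < 0 ∧ ContDiff ℝ ((⊤ : ℕ∞) : WithTop ℕ∞) ψ ∧
      (∀ x, HasDerivAt ψ (ψ' x) x) ∧ (∀ x, HasDerivAt ψ' (k ^ 2 * ψ x + f x) x) ∧ ψ' 0 = 0 ∧
      (∀ x ≤ a, f x = 0 ∧ ψ x = C * Complex.exp (k * x) ∧ ψ' x = k * (C * Complex.exp (k * x))) ∧
      ψ p = -∫ x in Iio (0 : ℝ), f x • modeGreen k p x := by
  obtain ⟨r, hr⟩ := hfc.isCompact.isBounded.subset_closedBall 0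
  have hfz : ∀ x ≤ min p (-(|r| + 1)), f x = 0 := by
    intro x hx
    by_contra hne
    have h1 := hr (subset_tsupport f hne)
    rw [Metric.mem_closedBall, dist_zero_right, Real.norm_eq_abs] at h1
    have h2 := hx.trans (min_le_right _ _)
    have h3 := (abs_le.mp (h1.trans (le_abs_self r))).1
    linarith
  -- To the left of both the pole and the support of `f`; the absolute value covers a negative
  -- radius `r`.
  set a := min p (-(|r| + 1)) with ha
  have hap : a ≤ p := min_le_left _ _
  have ha0 : a < 0 := hap.trans_lt hp
  have hfC : ContDiff ℝ ((⊤ : ℕ∞) : WithTop ℕ∞) fun t => (f t : ℂ) :=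
    Complex.ofRealCLM.contDiff.comp hf
  have hlin : ContDiff ℝ ((⊤ : ℕ∞) : WithTop ℕ∞) fun t : ℝ => k * (t : ℂ) :=
    contDiff_const.mul Complex.ofRealCLM.contDiff
  have hexp : ContDiff ℝ ((⊤ : ℕ∞) : WithTop ℕ∞) fun t : ℝ => Complex.exp (k * t) := hlin.cexp
  have hcosh : ContDiff ℝ ((⊤ : ℕ∞) : WithTop ℕ∞) fun t : ℝ => Complex.cosh (k * t) :=
    (hlin.cexp.add hlin.neg.cexp).div_const 2
  set e : ℝ → ℂ := fun t => Complex.exp (k * t) * f t with he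
  set d : ℝ → ℂ := fun t => Complex.cosh (k * t) * f t with hd
  have hes : ContDiff ℝ ((⊤ : ℕ∞) : WithTop ℕ∞) e := hexp.mul hfC
  have hds : ContDiff ℝ ((⊤ : ℕ∞) : WithTop ℕ∞) d := hcosh.mul hfC
  set A : ℝ → ℂ := fun x => ∫ t in (0 : ℝ)..x, d t with hA
  set B : ℝ → ℂ := fun x => ∫ t in a..x, e t with hB
  have hA' : ∀ x, HasDerivAt A (d x) x := fun x =>
    intervalIntegral.integral_hasDerivAt_right (hds.continuous.intervalIntegrable _ _)
      (hds.continuous.stronglyMeasurableAtFilter _ _) hds.continuous.continuousAt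
  have hB' : ∀ x, HasDerivAt B (e x) x := fun x =>
    intervalIntegral.integral_hasDerivAt_right (hes.continuous.intervalIntegrable _ _)
      (hes.continuous.stronglyMeasurableAtFilter _ _) hes.continuous.continuousAt
  -- Variation of constants with the outgoing solution `e^{kx}` and the Neumann solution `cosh(kx)`.
  -- The base point `0` of `A` gives `ψ'(0) = 0`; the base point `a` of `B` leaves a pure multiple
  -- of `e^{kx}` on the left of `a`.
  refine ⟨fun x => k⁻¹ * (Complex.exp (k * x) * A x - Complex.cosh (k * x) * B x),
    fun x => Complex.exp (k * x) * A x - Complex.sinh (k * x) * B x, k⁻¹ * A a, a, ha0,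
    ?_, fun x => ?_, fun x => ?_, ?_, fun x hx => ⟨hfz x hx, ?_⟩, ?_⟩
  · exact contDiff_const.mul ((hexp.mul (contDiff_integral hds 0)).sub
      (hcosh.mul (contDiff_integral hes a)))
  · have h := (((hasDerivAt_exp_mul_ofReal k x).mul (hA' x)).sub
      ((hasDerivAt_cosh_mul_ofReal k x).mul (hB' x))).const_mul k⁻¹
    convert! h using 1
    simp only [he, hd]
    field_simp
    ring
  · have h := (((hasDerivAt_exp_mul_ofReal k x).mul (hA' x)).sub
      ((hasDerivAt_sinh_mul_ofReal k x).mul (hB' x)))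
    convert! h using 1
    simp only [he, hd]
    have h2 : (Complex.cosh (k * x) - Complex.sinh (k * x)) * Complex.exp (k * x) = 1 := by
      rw [Complex.cosh_sub_sinh, ← Complex.exp_add]; simp
    field_simp
    linear_combination (-(f x : ℂ)) * h2
  · simp [hA]
  · have hz : ∀ t ≤ a, e t = 0 := fun t ht => by simp [he, hfz t ht]
    have hz' : ∀ t ≤ a, d t = 0 := fun t ht => by simp [hd, hfz t ht]
    have hB0 : B x = 0 := by
      simp only [hB]
      rw [intervalIntegral.integral_congr (g := fun _ => 0), intervalIntegral.integral_zero]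
      intro t ht
      rw [uIcc_of_ge hx] at ht
      exact hz t ht.2
    have hAx : A x = A a := by
      have h1 : A a + ∫ t in a..x, d t = A x := intervalIntegral.integral_add_adjacent_intervals
        (hds.continuous.intervalIntegrable _ _) (hds.continuous.intervalIntegrable _ _)
      rw [← h1, intervalIntegral.integral_congr (g := fun _ => 0), intervalIntegral.integral_zero,
        add_zero]
      intro t ht
      rw [uIcc_of_ge hx] at ht
      exact hz' t ht.2
    refine ⟨?_, ?_⟩
    · beta_reduce; rw [hB0, hAx]; ring
    · beta_reduce; rw [hB0, hAx]; field_simp; ring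
  · have h1 : ∫ x in Iio (0 : ℝ), f x • modeGreen k p x
        = ∫ x in a..0, f x • modeGreen k p x := by
      rw [intervalIntegral.integral_of_le ha0.le, ← integral_Iic_eq_integral_Iio]
      refine setIntegral_eq_of_subset_of_forall_sdiff_eq_zero measurableSet_Iic
        (fun x hx => hx.2) fun x hx => ?_
      have : x ≤ a := by
        by_contra h
        exact hx.2 ⟨not_le.mp h, hx.1⟩
      rw [hfz x this, zero_smul]
    have hci : ∀ u v, IntervalIntegrable (fun x => f x • modeGreen k p x) volume u v := fun u v =>
      (hf.continuous.smul (continuous_modeGreen k p)).intervalIntegrable _ _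
    rw [h1, ← intervalIntegral.integral_add_adjacent_intervals (hci a p) (hci p 0)]
    have h2 : ∫ x in a..p, f x • modeGreen k p x = Complex.cosh (k * p) / k * B p := by
      simp only [hB]
      rw [← intervalIntegral.integral_const_mul]
      refine intervalIntegral.integral_congr fun t ht => ?_
      rw [uIcc_of_le hap] at ht
      simp only [he]
      rw [modeGreen_of_le hp ht.2, Complex.real_smul]
      ring
    have h3 : ∫ x in p..0, f x • modeGreen k p x = -(Complex.exp (k * p) / k * A p) := by
      simp only [hA]
      rw [intervalIntegral.integral_symm p 0, mul_neg, neg_neg,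
        ← intervalIntegral.integral_const_mul]
      refine intervalIntegral.integral_congr fun t ht => ?_
      rw [uIcc_of_le hp.le] at ht
      simp only [hd]
      rw [modeGreen_of_ge ht.2 hp ht.1, Complex.real_smul]
      ring
    rw [h2, h3]
    field_simp
    ring

/-! ### Cutoffs and uniqueness of the outgoing solution on the half-line -/

lemma contDiff_deriv_smoothTransition :
    ContDiff ℝ ((⊤ : ℕ∞) : WithTop ℕ∞) (deriv Real.smoothTransition) :=
  (contDiff_infty_iff_deriv.mp Real.smoothTransition.contDiff).2

lemma hasDerivAt_smoothTransition (x : ℝ) :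
    HasDerivAt Real.smoothTransition (deriv Real.smoothTransition x) x :=
  ((contDiff_infty_iff_deriv.mp Real.smoothTransition.contDiff).1 x).hasDerivAt

lemma hasDerivAt_deriv_smoothTransition (x : ℝ) :
    HasDerivAt (deriv Real.smoothTransition) (deriv (deriv Real.smoothTransition) x) x :=
  ((contDiff_infty_iff_deriv.mp contDiff_deriv_smoothTransition).1 x).hasDerivAt

lemma continuous_deriv_deriv_smoothTransition : Continuous (deriv (deriv Real.smoothTransition)) :=
  (contDiff_infty_iff_deriv.mp contDiff_deriv_smoothTransition).2.continuous

lemma deriv_smoothTransition_of_nonpos {x : ℝ} (hx : x ≤ 0) :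
    deriv Real.smoothTransition x = 0 := by
  refine IsLocalMin.deriv_eq_zero (Eventually.of_forall fun y => ?_)
  rw [Real.smoothTransition.zero_of_nonpos hx]
  exact Real.smoothTransition.nonneg y

lemma deriv_smoothTransition_of_one_le {x : ℝ} (hx : 1 ≤ x) :
    deriv Real.smoothTransition x = 0 := by
  refine IsLocalMax.deriv_eq_zero (Eventually.of_forall fun y => ?_)
  rw [Real.smoothTransition.one_of_one_le hx]
  exact Real.smoothTransition.le_one y

lemma deriv_deriv_smoothTransition_of_neg {x : ℝ} (hx : x < 0) :
    deriv (deriv Real.smoothTransition) x = 0 := by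
  have : deriv Real.smoothTransition =ᶠ[𝓝 x] fun _ => 0 := by
    filter_upwards [Iio_mem_nhds hx] with y hy using deriv_smoothTransition_of_nonpos (le_of_lt hy)
  rw [this.deriv_eq, deriv_const]

lemma deriv_deriv_smoothTransition_of_one_lt {x : ℝ} (hx : 1 < x) :
    deriv (deriv Real.smoothTransition) x = 0 := by
  have : deriv Real.smoothTransition =ᶠ[𝓝 x] fun _ => 0 := by
    filter_upwards [Ioi_mem_nhds hx] with y hy using deriv_smoothTransition_of_one_le (le_of_lt hy)
  rw [this.deriv_eq, deriv_const]

/-- The commutator of `∂² - k²` with the cutoff at `0`, applied to `e^{kx}`, up to the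
factor `e^{kx}`. -/
noncomputable def cutoffDefect (k : ℂ) (v : ℝ) : ℂ :=
  2 * k * (deriv Real.smoothTransition v : ℝ) + (deriv (deriv Real.smoothTransition) v : ℝ)

lemma continuous_cutoffDefect (k : ℂ) : Continuous (cutoffDefect k) := by
  have h1 := contDiff_deriv_smoothTransition.continuous
  have h2 := continuous_deriv_deriv_smoothTransition
  unfold cutoffDefect
  fun_prop

lemma cutoffDefect_eq_zero (k : ℂ) {v : ℝ} (hv : v < 0 ∨ 1 < v) : cutoffDefect k v = 0 := by
  rw [cutoffDefect]
  rcases hv with hv | hv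
  · rw [deriv_smoothTransition_of_nonpos hv.le, deriv_deriv_smoothTransition_of_neg hv]; simp
  · rw [deriv_smoothTransition_of_one_le hv.le, deriv_deriv_smoothTransition_of_one_lt hv]; simp

/-- The integrand is the derivative of `χ'(x + R) e^{2kx}`, with `χ` the cutoff, and `χ'` vanishes
at `0` and `1`. Hence the outgoing wave itself contributes nothing to the commutator term, even when
it does not decay. -/
lemma integral_exp_mul_cutoffDefect_mul_exp (k : ℂ) (R : ℝ) :
    ∫ x in (-R)..(1 - R), Complex.exp (k * x) * (cutoffDefect k (x + R) * Complex.exp (k * x))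
      = 0 := by
  have hd : ∀ x : ℝ, HasDerivAt (fun x : ℝ => ((deriv Real.smoothTransition (x + R) : ℝ) : ℂ)
      * Complex.exp ((2 * k) * x))
      (Complex.exp (k * x) * (cutoffDefect k (x + R) * Complex.exp (k * x))) x := by
    intro x
    have h1 : HasDerivAt (fun x : ℝ => ((deriv Real.smoothTransition (x + R) : ℝ) : ℂ))
        ((deriv (deriv Real.smoothTransition) (x + R) : ℝ) : ℂ) x :=
      ((hasDerivAt_deriv_smoothTransition (x + R)).comp_add_const x R).ofReal_comp
    convert! h1.mul (hasDerivAt_exp_mul_ofReal (2 * k) x) using 1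
    have h2 : Complex.exp (2 * k * x) = Complex.exp (k * x) * Complex.exp (k * x) := by
      rw [← Complex.exp_add]; congr 1; ring
    rw [h2, cutoffDefect]
    ring
  rw [intervalIntegral.integral_eq_sub_of_hasDerivAt (fun x _ => hd x)]
  · rw [deriv_smoothTransition_of_one_le (by linarith),
      deriv_smoothTransition_of_nonpos (by linarith)]
    simp
  · refine Continuous.intervalIntegrable ?_ _ _
    have := continuous_cutoffDefect k
    fun_prop

lemma integrableOn_mul_of_eq_zero {c h : ℝ → ℂ} {R : ℝ}
    (hc : IntegrableOn c (Ioo (-R) 0)) (hh : Continuous h) (hz : ∀ x ≤ -R, h x = 0) :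
    IntegrableOn (fun x => c x * h x) (Iio 0) := by
  obtain ⟨C, hC⟩ := isCompact_Icc.exists_bound_of_continuousOn
      (f := h) (s := Icc (-R) 0) hh.continuousOn
  have h1 : IntegrableOn (fun x => c x * h x) (Ioo (-R) 0) := by
    refine Integrable.mul_bdd (c := C) hc hh.aestronglyMeasurable ?_
    filter_upwards [ae_restrict_mem measurableSet_Ioo] with y hy
    exact hC y (Ioo_subset_Icc_self hy)
  refine h1.of_forall_sdiff_eq_zero measurableSet_Iio fun x hx => ?_
  have : x ≤ -R := by
    by_contra h
    exact hx.2 ⟨not_le.mp h, hx.1⟩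
  rw [hz x this, mul_zero]

/-- The commutator terms vanish in the limit for outgoing functions. -/
lemma tendsto_integral_cutoffDefect {k s : ℂ} (hk : 0 ≤ k.re) {c : ℝ → ℂ}
    (hc : ∀ R : ℝ, IntegrableOn c (Ioo (-R) 0)) {α C x₀ : ℝ} (hα : 0 < α)
    (hout : ∀ᵐ x : ℝ, x < 0 → x ≤ x₀ → ‖c x - s * Complex.exp (k * x)‖ ≤ C * Real.exp (α * x)) :
    Tendsto (fun R : ℝ => ∫ x in Iio (0 : ℝ), c x * (cutoffDefect k (x + R) * Complex.exp (k * x)))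
      atTop (𝓝 0) := by
  obtain ⟨M, hM⟩ := isCompact_Icc.exists_bound_of_continuousOn
      (f := cutoffDefect k) (s := Icc 0 1) (continuous_cutoffDefect k).continuousOn
  have hM0 : 0 ≤ M := (norm_nonneg _).trans (hM 0 (by simp))
  have hlim : Tendsto (fun R : ℝ => |C| * M * Real.exp (α * (1 - R))) atTop (𝓝 0) := by
    have h1 : Tendsto (fun R : ℝ => α * (1 - R)) atTop atBot :=
      (tendsto_atBot_add_const_left _ 1 tendsto_neg_atTop_atBot).const_mul_atBot hα
    simpa using (Real.tendsto_exp_atBot.comp h1).const_mul (|C| * M)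
  refine squeeze_zero_norm' ?_ hlim
  filter_upwards [eventually_gt_atTop 1, eventually_gt_atTop (1 - x₀)] with R hR1 hR2
  have hcont : Continuous fun x : ℝ => cutoffDefect k (x + R) * Complex.exp (k * x) := by
    have := continuous_cutoffDefect k
    fun_prop
  have hloc : ∫ x in Iio (0 : ℝ), c x * (cutoffDefect k (x + R) * Complex.exp (k * x))
      = ∫ x in (-R)..(1 - R), c x * (cutoffDefect k (x + R) * Complex.exp (k * x)) := by
    rw [intervalIntegral.integral_of_le (by linarith), ← integral_Icc_eq_integral_Ioc]
    refine setIntegral_eq_of_subset_of_forall_sdiff_eq_zero measurableSet_Iio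
      (fun x hx => mem_Iio.mpr (by linarith [hx.2])) fun x hx => ?_
    rw [cutoffDefect_eq_zero, zero_mul, mul_zero]
    by_contra h
    push Not at h
    exact hx.2 ⟨by linarith [h.1], by linarith [h.2]⟩
  have hci : IntervalIntegrable (fun x => c x * (cutoffDefect k (x + R) * Complex.exp (k * x)))
      volume (-R) (1 - R) := by
    rw [intervalIntegrable_iff_integrableOn_Ioc_of_le (by linarith)]
    -- `R + 1` instead of `R`, because `cutoffDefect_eq_zero` requires a strictly negative argument.
    refine (integrableOn_mul_of_eq_zero (hc (R + 1)) hcont fun x hx => ?_).mono_set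
      fun x hx => mem_Iio.mpr (by linarith [hx.2])
    rw [cutoffDefect_eq_zero _ (Or.inl (by linarith)), zero_mul]
  have hsi : IntervalIntegrable (fun x : ℝ => s * (Complex.exp (k * x) *
      (cutoffDefect k (x + R) * Complex.exp (k * x)))) volume (-R) (1 - R) := by
    refine Continuous.intervalIntegrable ?_ _ _
    fun_prop
  -- Subtracting `s e^{kx}` from `c` does not change the integral; the exponentially small remainder
  -- is then integrated over an interval of length one moving to `-∞`.
  have hsub := intervalIntegral.integral_sub hci hsi
  rw [intervalIntegral.integral_const_mul, integral_exp_mul_cutoffDefect_mul_exp, mul_zero,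
    sub_zero] at hsub
  rw [hloc, ← hsub]
  have hb := intervalIntegral.norm_integral_le_of_norm_le_const_ae (a := -R) (b := 1 - R)
    (C := |C| * M * Real.exp (α * (1 - R))) (f := fun x : ℝ =>
      c x * (cutoffDefect k (x + R) * Complex.exp (k * x)) - s * (Complex.exp (k * x) *
      (cutoffDefect k (x + R) * Complex.exp (k * x)))) ?_
  · simpa using hb
  filter_upwards [hout] with x hx hxm
  rw [uIoc_of_le (by linarith)] at hxm
  have hxm2 := hxm.2
  have hxm1 := hxm.1
  have h1 := hx (by linarith) (by linarith)
  have h2 : ‖cutoffDefect k (x + R)‖ ≤ M := hM _ ⟨by linarith, by linarith⟩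
  have h3 : ‖Complex.exp (k * x)‖ ≤ 1 := by
    rw [Complex.norm_exp, Real.exp_le_one_iff]
    simp only [Complex.mul_re, Complex.ofReal_re, Complex.ofReal_im, mul_zero, sub_zero]
    exact mul_nonpos_of_nonneg_of_nonpos hk (by linarith)
  have h4 : C * Real.exp (α * x) ≤ |C| * Real.exp (α * (1 - R)) := by
    refine mul_le_mul (le_abs_self C) (Real.exp_le_exp.mpr ?_) (Real.exp_pos _).le (abs_nonneg C)
    exact mul_le_mul_of_nonneg_left (by linarith) hα.le
  rw [← mul_assoc s, ← sub_mul, norm_mul, norm_mul]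
  calc ‖c x - s * Complex.exp (k * x)‖ * (‖cutoffDefect k (x + R)‖ * ‖Complex.exp (k * x)‖)
      ≤ (|C| * Real.exp (α * (1 - R))) * (M * 1) := by
        refine mul_le_mul (h1.trans h4) (mul_le_mul h2 h3 (norm_nonneg _) hM0) (by positivity)
          (by positivity)
    _ = |C| * M * Real.exp (α * (1 - R)) := by ring

/-- An outgoing weak solution of `k²c - d²c/dx² = δ_p` on the half-line with the Neumann condition
is the Green function. -/
theorem ae_eq_modeGreen {k s : ℂ} (hk0 : k ≠ 0) (hk : 0 ≤ k.re) {p : ℝ} (hp : p < 0) {c : ℝ → ℂ}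
    (hc : ∀ R : ℝ, IntegrableOn c (Ioo (-R) 0)) {α C x₀ : ℝ} (hα : 0 < α)
    (hout : ∀ᵐ x : ℝ, x < 0 → x ≤ x₀ → ‖c x - s * Complex.exp (k * x)‖ ≤ C * Real.exp (α * x))
    (hweak : ∀ Ψ : ℝ → ℂ, ContDiff ℝ ((⊤ : ℕ∞) : WithTop ℕ∞) Ψ → HasCompactSupport Ψ →
      deriv Ψ 0 = 0 → ∫ x in Iio (0 : ℝ), c x * (deriv (deriv Ψ) x - k ^ 2 * Ψ x) = -Ψ p) :
    ∀ᵐ x : ℝ, x < 0 → c x = modeGreen k p x := by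
  have hloc : LocallyIntegrableOn (fun x => c x - modeGreen k p x) (Iio 0) := by
    intro x hx
    refine ⟨Ioo (x - 1) 0, ?_, ?_⟩
    · rw [(isOpen_Iio).nhdsWithin_eq hx]
      exact Ioo_mem_nhds (by linarith) hx
    · have h1 := hc (1 - x)
      rw [neg_sub] at h1
      exact h1.sub (((continuous_modeGreen k p).integrableOn_Icc (a := x - 1) (b := 0)).mono_set
        Ioo_subset_Icc_self)
  have hfin := isOpen_Iio.ae_eq_zero_of_integral_contDiff_smul_eq_zero hloc ?_
  · filter_upwards [hfin] with x hx hx0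
    exact sub_eq_zero.mp (hx hx0)
  intro f hf hfc hft
  obtain ⟨ψ, ψ', D, a, ha, hψs, hψ, hψ', hψ0, hψa, hψp⟩ := exists_outgoing_potential hk0 hp hf hfc
  have hfC : Continuous fun x => (f x : ℂ) := Complex.continuous_ofReal.comp hf.continuous
  have hcf : IntegrableOn (fun x => c x * f x) (Iio 0) :=
    integrableOn_mul_of_eq_zero (hc (-a)) hfC fun x hx => by
      rw [neg_neg] at hx
      rw [(hψa x hx).1]; simp
  have hgf : IntegrableOn (fun x => modeGreen k p x * f x) (Iio 0) :=
    integrableOn_mul_of_eq_zero (R := -a) (((continuous_modeGreen k p).integrableOn_Icc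
      (a := - -a) (b := 0)).mono_set Ioo_subset_Icc_self) hfC fun x hx => by
      rw [neg_neg] at hx
      rw [(hψa x hx).1]; simp
  -- The test function is the potential of `f`, cut off near `-R`. `R > 1 - a` makes `ψ` a pure
  -- multiple of `e^{kx}` and `f` zero wherever the cutoff is not yet `1`, and `R > 1 - p` makes the
  -- cutoff `1` at the pole.
  have hstep : ∀ R : ℝ, 1 - a < R → 1 - p < R →
      (∫ x in Iio (0 : ℝ), c x * f x) + D * ∫ x in Iio (0 : ℝ),
        c x * (cutoffDefect k (x + R) * Complex.exp (k * x)) = -ψ p := by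
    intro R hRa hRp
    -- The factor in `2 - x` only ensures compact support on the right: it is `1` for `x < 1`, hence
    -- near the half-line.
    set Ψ : ℝ → ℂ := fun x =>
      ((Real.smoothTransition (x + R) * Real.smoothTransition (2 - x) : ℝ) : ℂ) * ψ x with hΨ
    have hΨs : ContDiff ℝ ((⊤ : ℕ∞) : WithTop ℕ∞) Ψ := by
      refine (Complex.ofRealCLM.contDiff.comp ?_).mul hψs
      exact (Real.smoothTransition.contDiff.comp (contDiff_id.add contDiff_const)).mul
        (Real.smoothTransition.contDiff.comp (contDiff_const.sub contDiff_id))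
    have hΨc : HasCompactSupport Ψ := by
      refine HasCompactSupport.intro (isCompact_Icc (a := -R) (b := 2)) fun x hx => ?_
      have : Real.smoothTransition (x + R) * Real.smoothTransition (2 - x) = 0 := by
        by_cases h : -R ≤ x
        · have h2 : 2 < x := by
            by_contra h2
            exact hx ⟨h, not_lt.mp h2⟩
          rw [Real.smoothTransition.zero_of_nonpos (x := 2 - x) (by linarith), mul_zero]
        · rw [Real.smoothTransition.zero_of_nonpos (by linarith), zero_mul]
      simp only [hΨ]
      rw [this, Complex.ofReal_zero, zero_mul]
    have hκ : ∀ x, HasDerivAt (fun x => ((Real.smoothTransition (x + R) : ℝ) : ℂ))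
        ((deriv Real.smoothTransition (x + R) : ℝ) : ℂ) x := fun x =>
      ((hasDerivAt_smoothTransition (x + R)).comp_add_const x R).ofReal_comp
    have hκ' : ∀ x, HasDerivAt (fun x => ((deriv Real.smoothTransition (x + R) : ℝ) : ℂ))
        ((deriv (deriv Real.smoothTransition) (x + R) : ℝ) : ℂ) x := fun x =>
      ((hasDerivAt_deriv_smoothTransition (x + R)).comp_add_const x R).ofReal_comp
    have hΨeq : ∀ x < 1, Ψ x = ((Real.smoothTransition (x + R) : ℝ) : ℂ) * ψ x := by
      intro x hx
      simp only [hΨ]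
      rw [Real.smoothTransition.one_of_one_le (x := 2 - x) (by linarith), mul_one]
    have hΨ1 : ∀ x < 1, deriv Ψ x = ((deriv Real.smoothTransition (x + R) : ℝ) : ℂ) * ψ x
        + ((Real.smoothTransition (x + R) : ℝ) : ℂ) * ψ' x := by
      intro x hx
      have h1 : Ψ =ᶠ[𝓝 x] fun x => ((Real.smoothTransition (x + R) : ℝ) : ℂ) * ψ x := by
        filter_upwards [Iio_mem_nhds hx] with y hy using hΨeq y hy
      rw [h1.deriv_eq]
      exact ((hκ x).mul (hψ x)).deriv
    have hΨ2 : ∀ x < 1, deriv (deriv Ψ) x =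
        ((deriv (deriv Real.smoothTransition) (x + R) : ℝ) : ℂ) * ψ x
        + 2 * ((deriv Real.smoothTransition (x + R) : ℝ) : ℂ) * ψ' x
        + ((Real.smoothTransition (x + R) : ℝ) : ℂ) * (k ^ 2 * ψ x + f x) := by
      intro x hx
      have h1 : deriv Ψ =ᶠ[𝓝 x] fun x => ((deriv Real.smoothTransition (x + R) : ℝ) : ℂ) * ψ x
        + ((Real.smoothTransition (x + R) : ℝ) : ℂ) * ψ' x := by
        filter_upwards [Iio_mem_nhds hx] with y hy using hΨ1 y hy
      rw [h1.deriv_eq]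
      refine ((((hκ' x).mul (hψ x)).add ((hκ x).mul (hψ' x))).congr_deriv ?_).deriv
      ring
    have hw := hweak Ψ hΨs hΨc (by
      rw [hΨ1 0 one_pos, hψ0, deriv_smoothTransition_of_one_le (by linarith)]; simp)
    rw [hΨeq p (by linarith), Real.smoothTransition.one_of_one_le (by linarith),
      Complex.ofReal_one, one_mul] at hw
    rw [← hw, ← integral_const_mul, ← integral_add hcf]
    · refine setIntegral_congr_fun measurableSet_Iio fun x hx => ?_
      have hx0 : x < 0 := hx
      rw [hΨ2 x (by linarith), hΨeq x (by linarith)]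
      by_cases hxR : 1 < x + R
      · rw [cutoffDefect_eq_zero _ (Or.inr hxR), deriv_smoothTransition_of_one_le hxR.le,
          deriv_deriv_smoothTransition_of_one_lt hxR, Real.smoothTransition.one_of_one_le hxR.le]
        push_cast
        ring
      · obtain ⟨h1, h2, h3⟩ := hψa x (by linarith)
        rw [h1, h2, h3, cutoffDefect]
        push_cast
        ring
    · refine (integrableOn_mul_of_eq_zero (hc (R + 1)) ?_ fun x hx => ?_).const_mul D
      · have := continuous_cutoffDefect k
        fun_prop
      · rw [cutoffDefect_eq_zero _ (Or.inl (by linarith)), zero_mul]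
  have hlim := ((tendsto_integral_cutoffDefect hk hc hα hout).const_mul D).const_add
    (∫ x in Iio (0 : ℝ), c x * f x)
  rw [mul_zero, add_zero] at hlim
  have heq : (∫ x in Iio (0 : ℝ), c x * f x) = -ψ p := by
    refine tendsto_nhds_unique hlim (tendsto_const_nhds.congr' ?_)
    filter_upwards [eventually_gt_atTop (1 - a), eventually_gt_atTop (1 - p)] with R h1 h2
    exact (hstep R h1 h2).symm
  rw [hψp, neg_neg] at heq
  rw [← setIntegral_eq_integral_of_forall_compl_eq_zero (s := Iio 0) (fun x hx => by
    rw [image_eq_zero_of_notMem_tsupport fun h => hx (hft h), zero_smul])]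
  have h5 : ∀ x, f x • (c x - modeGreen k p x) = c x * f x - modeGreen k p x * f x := fun x => by
    rw [Complex.real_smul]; ring
  simp_rw [h5]
  rw [integral_sub hcf hgf, heq, sub_eq_zero]
  congr 1; ext x
  rw [Complex.real_smul]; ring

/-! ### Cosine coefficients of the solution and its amplitude -/

/-- The exponents of the modes of the strip: the first one is propagating, the others are
evanescent. -/
noncomputable def waveNumber (ω : ℝ) (n : ℕ) : ℂ :=
  if n = 0 then -(Complex.I * ω) else (√((n * Real.pi) ^ 2 - ω ^ 2) : ℝ)

lemma sq_lt_sq_mul_pi {ω : ℝ} (hω : 0 < ω) (hωπ : ω < Real.pi) {n : ℕ} (hn : n ≠ 0) :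
    ω ^ 2 < (n * Real.pi) ^ 2 := by
  have h1 : (1 : ℝ) ≤ n := by exact_mod_cast Nat.one_le_iff_ne_zero.mpr hn
  refine pow_lt_pow_left₀ (hωπ.trans_le ?_) hω.le two_ne_zero
  exact le_mul_of_one_le_left Real.pi_pos.le h1

lemma waveNumber_sq {ω : ℝ} (hω : 0 < ω) (hωπ : ω < Real.pi) (n : ℕ) :
    waveNumber ω n ^ 2 = (((n * Real.pi) ^ 2 - ω ^ 2 : ℝ) : ℂ) := by
  rw [waveNumber]
  split_ifs with hn
  · subst hn
    rw [neg_sq, mul_pow, Complex.I_sq]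
    push_cast
    ring
  · rw [← Complex.ofReal_pow, Real.sq_sqrt (sub_nonneg.mpr (sq_lt_sq_mul_pi hω hωπ hn).le)]

lemma waveNumber_ne_zero {ω : ℝ} (hω : 0 < ω) (hωπ : ω < Real.pi) (n : ℕ) :
    waveNumber ω n ≠ 0 := by
  intro h
  have h1 := waveNumber_sq hω hωπ n
  rw [h, zero_pow two_ne_zero, eq_comm, Complex.ofReal_eq_zero] at h1
  by_cases hn : n = 0
  · subst hn
    simp [hω.ne'] at h1
  · linarith [sq_lt_sq_mul_pi hω hωπ hn]

lemma waveNumber_re_nonneg (ω : ℝ) (n : ℕ) : 0 ≤ (waveNumber ω n).re := by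
  rw [waveNumber]
  split_ifs
  · simp
  · rw [Complex.ofReal_re]; positivity

/-- The coefficients of `γ` in the modes of the cross-section. -/
noncomputable def modeCoeff (γ : ℝ × ℝ → ℂ) (n : ℕ) (x : ℝ) : ℂ :=
  ∫ y in Ioo (0 : ℝ) 1, crossMode n y • γ (x, y)

lemma strip_inter (R : ℝ) : strip ∩ {z | -R < z.1} = Ioo (-R) 0 ×ˢ Ioo 0 1 := by
  ext ⟨x, y⟩
  simp only [strip, mem_inter_iff, mem_prod, mem_Iio, mem_Ioo, mem_ofPred_eq]
  tauto

lemma measurableSet_strip : MeasurableSet strip := measurableSet_Iio.prod measurableSet_Ioo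

section coefficients

variable {ω p : ℝ} {γ : ℝ × ℝ → ℂ}

lemma IsPointSourceSolution.integrable_prod (hγ : IsPointSourceSolution ω p γ) (R : ℝ) :
    Integrable γ ((volume.restrict (Ioo (-R) 0)).prod (volume.restrict (Ioo (0 : ℝ) 1))) := by
  have := hγ.integrableOn R
  rwa [strip_inter, IntegrableOn, Measure.volume_eq_prod, ← Measure.prod_restrict] at this

lemma IsPointSourceSolution.integrable_slice (hγ : IsPointSourceSolution ω p γ) :
    ∀ᵐ x : ℝ, x < 0 → IntegrableOn (fun y => γ (x, y)) (Ioo 0 1) := by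
  have h : ∀ N : ℕ, ∀ᵐ x : ℝ, x ∈ Ioo (-(N : ℝ)) 0 → IntegrableOn (fun y => γ (x, y)) (Ioo 0 1) :=
    fun N => (ae_restrict_iff' measurableSet_Ioo).mp (hγ.integrable_prod N).prod_right_ae
  filter_upwards [ae_all_iff.mpr h] with x hx hx0
  obtain ⟨N, hN⟩ := exists_nat_gt (-x)
  exact hx N ⟨by linarith, hx0⟩

lemma IsPointSourceSolution.integrableOn_modeCoeff (hγ : IsPointSourceSolution ω p γ) (n : ℕ)
    (R : ℝ) : IntegrableOn (modeCoeff γ n) (Ioo (-R) 0) := by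
  have h := integrable_smul_of_bounded (hγ.integrable_prod R) (h := fun z => crossMode n z.2)
    ((continuous_crossMode n).comp continuous_snd).aestronglyMeasurable 1
    fun z => abs_crossMode_le_one n z.2
  exact h.integral_prod_left

lemma deriv_crossMode (n : ℕ) (y : ℝ) :
    HasDerivAt (crossMode n) (n * Real.pi * Real.sin (n * Real.pi * (1 - y))) y := by
  have h := (((hasDerivAt_id y).const_sub 1).const_mul (n * Real.pi)).cos
  refine (h.congr_deriv ?_)
  simp [mul_comm]

lemma deriv_deriv_crossMode (n : ℕ) (y : ℝ) :
    HasDerivAt (fun y => n * Real.pi * Real.sin (n * Real.pi * (1 - y)))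
      (-((n * Real.pi) ^ 2 * crossMode n y)) y := by
  have h := ((((hasDerivAt_id y).const_sub 1).const_mul (n * Real.pi)).sin).const_mul
    (n * Real.pi)
  refine (h.congr_deriv ?_)
  simp only [crossMode, id]
  ring

lemma contDiff_crossMode (n : ℕ) : ContDiff ℝ ((⊤ : ℕ∞) : WithTop ℕ∞) (crossMode n) := by
  unfold crossMode
  fun_prop

/-- The mode `crossMode n`, cut off away from the cross-section. -/
lemma exists_compactlySupported_crossMode (n : ℕ) :
    ∃ θ : ℝ → ℝ, ContDiff ℝ ((⊤ : ℕ∞) : WithTop ℕ∞) θ ∧ HasCompactSupport θ ∧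
      ∀ y ∈ Ioo (-1 : ℝ) 2, θ y = crossMode n y := by
  refine ⟨fun y => Real.smoothTransition (y + 2) * Real.smoothTransition (3 - y) * crossMode n y,
    ?_, ?_, fun y hy => ?_⟩
  · exact ((Real.smoothTransition.contDiff.comp (contDiff_id.add contDiff_const)).mul
        (Real.smoothTransition.contDiff.comp (contDiff_const.sub contDiff_id))).mul
        (contDiff_crossMode n)
  · refine HasCompactSupport.intro (isCompact_Icc (a := -2) (b := 3)) fun y hy => ?_
    by_cases h : -2 ≤ y
    · have h2 : 3 < y := by
        by_contra h2
        exact hy ⟨h, not_lt.mp h2⟩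
      rw [Real.smoothTransition.zero_of_nonpos (x := 3 - y) (by linarith), mul_zero, zero_mul]
    · rw [Real.smoothTransition.zero_of_nonpos (by linarith), zero_mul, zero_mul]
  · beta_reduce
    rw [Real.smoothTransition.one_of_one_le (by linarith [hy.1]),
      Real.smoothTransition.one_of_one_le (by linarith [hy.2]), one_mul, one_mul]

/-- Fubini for the test function `ψ(x) θ(y)`, with `θ` the truncated mode. It satisfies the Neumann
conditions because `sin(nπ) = sin 0 = 0` and `ψ'(0) = 0`; the source term carries no factor because
the modes are `1` at `y = 1`. -/
lemma IsPointSourceSolution.integral_modeCoeff_real (hγ : IsPointSourceSolution ω p γ) (n : ℕ)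
    {ψ : ℝ → ℝ} (hψ : ContDiff ℝ ((⊤ : ℕ∞) : WithTop ℕ∞) ψ) (hψc : HasCompactSupport ψ)
    (hψ0 : deriv ψ 0 = 0) :
    ∫ x in Iio (0 : ℝ), modeCoeff γ n x *
      ((deriv (deriv ψ) x - ((n * Real.pi) ^ 2 - ω ^ 2) * ψ x : ℝ) : ℂ) = -(ψ p : ℂ) := by
  obtain ⟨θ, hθ, hθc, hθeq⟩ := exists_compactlySupported_crossMode n
  have hθev : ∀ y ∈ Ioo (-1 : ℝ) 2, θ =ᶠ[𝓝 y] crossMode n := fun y hy => by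
    filter_upwards [Ioo_mem_nhds hy.1 hy.2] with t ht using hθeq t ht
  have hθ1 : ∀ y ∈ Ioo (-1 : ℝ) 2, deriv θ y = n * Real.pi * Real.sin (n * Real.pi * (1 - y)) :=
    fun y hy => by rw [(hθev y hy).deriv_eq, (deriv_crossMode n y).deriv]
  have hθ2 : ∀ y ∈ Ioo (-1 : ℝ) 2, deriv (deriv θ) y = -((n * Real.pi) ^ 2 * crossMode n y) := by
    intro y hy
    have : deriv θ =ᶠ[𝓝 y] fun y => n * Real.pi * Real.sin (n * Real.pi * (1 - y)) := by
      filter_upwards [Ioo_mem_nhds hy.1 hy.2] with t ht using hθ1 t ht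
    rw [this.deriv_eq, (deriv_deriv_crossMode n y).deriv]
  have hψd := contDiff_infty_iff_deriv.mp hψ
  have hψdd := contDiff_infty_iff_deriv.mp hψd.2
  have hθd := contDiff_infty_iff_deriv.mp hθ
  have hθdd := contDiff_infty_iff_deriv.mp hθd.2
  have htest : IsNeumannTest fun z => ψ z.1 * θ z.2 := by
    refine ⟨(hψ.comp contDiff_fst).mul (hθ.comp contDiff_snd), ?_, fun x _ => ?_, fun x _ => ?_,
      fun y _ => ?_⟩
    · refine HasCompactSupport.intro (hψc.isCompact.prod hθc.isCompact) fun z hz => ?_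
      by_cases h : z.1 ∈ tsupport ψ
      · rw [image_eq_zero_of_notMem_tsupport fun h2 : z.2 ∈ tsupport θ => hz ⟨h, h2⟩, mul_zero]
      · rw [image_eq_zero_of_notMem_tsupport h, zero_mul]
    · simp only
      rw [deriv_const_mul _ (hθd.1 0), hθ1 0 (by norm_num)]
      simp [Real.sin_nat_mul_pi]
    · simp only
      rw [deriv_const_mul _ (hθd.1 1), hθ1 1 (by norm_num)]
      simp
    · simp only
      rw [deriv_mul_const (hψd.1 0), hψ0, zero_mul]
  have hlap : ∀ z ∈ strip, laplacian (fun z => ψ z.1 * θ z.2) z + ω ^ 2 * (ψ z.1 * θ z.2)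
      = (deriv (deriv ψ) z.1 - ((n * Real.pi) ^ 2 - ω ^ 2) * ψ z.1) * crossMode n z.2 := by
    rintro ⟨x, y⟩ ⟨-, hy⟩
    have hy' : y ∈ Ioo (-1 : ℝ) 2 := ⟨by linarith [hy.1], by linarith [hy.2]⟩
    have h1 : deriv (fun x => ψ x * θ y) = fun x => deriv ψ x * θ y :=
      funext fun t => deriv_mul_const (hψd.1 t) _
    have h2 : deriv (fun y => ψ x * θ y) = fun y => ψ x * deriv θ y :=
      funext fun t => deriv_const_mul _ (hθd.1 t)
    simp only [laplacian, iteratedDeriv_succ, iteratedDeriv_zero]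
    rw [h1, h2, deriv_mul_const (hψdd.1 x), deriv_const_mul _ (hθdd.1 y), hθ2 y hy', hθeq y hy']
    ring
  have hw := hγ.weak _ htest
  have hθone : θ 1 = 1 := by rw [hθeq 1 (by norm_num)]; simp [crossMode]
  rw [hθone, mul_one] at hw
  rw [← hw]
  set h : ℝ → ℝ := fun x => deriv (deriv ψ) x - ((n * Real.pi) ^ 2 - ω ^ 2) * ψ x with hh
  have hhc : Continuous h := hψdd.2.continuous.sub (continuous_const.mul hψ.continuous)
  have hhs : HasCompactSupport h := by
    have h1 : HasCompactSupport fun x => ((n * Real.pi) ^ 2 - ω ^ 2) * ψ x := hψc.mul_left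
    exact hψc.deriv.deriv.sub h1
  obtain ⟨M, hM⟩ := hhc.bounded_above_of_compact_support hhs
  obtain ⟨R, hR⟩ := hhs.isCompact.isBounded.subset_closedBall 0
  have hint : IntegrableOn (fun z : ℝ × ℝ => γ z * ((h z.1 * crossMode n z.2 : ℝ) : ℂ))
      (Iio 0 ×ˢ Ioo 0 1) (volume.prod volume) := by
    have h1 : IntegrableOn (fun z : ℝ × ℝ => (h z.1 * crossMode n z.2) • γ z)
        (strip ∩ {z | -(R + 1) < z.1}) := by
      refine integrable_smul_of_bounded (hγ.integrableOn (R + 1)) ((hhc.comp continuous_fst).mul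
        ((continuous_crossMode n).comp continuous_snd)).aestronglyMeasurable M fun z => ?_
      rw [abs_mul]
      exact (mul_le_of_le_one_right (abs_nonneg _) (abs_crossMode_le_one n _)).trans (hM z.1)
    have h2 := h1.of_forall_sdiff_eq_zero measurableSet_strip fun z hz => by
      have hz1 : h z.1 = 0 := by
        refine image_eq_zero_of_notMem_tsupport fun hz' => hz.2 ⟨hz.1, ?_⟩
        have h3 := hR hz'
        rw [Metric.mem_closedBall, dist_zero_right, Real.norm_eq_abs] at h3
        have h4 := (abs_le.mp h3).1
        change -(R + 1) < z.1
        linarith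
      rw [hz1, zero_mul, zero_smul]
    rw [← Measure.volume_eq_prod]
    refine h2.congr_fun (fun z _ => ?_) measurableSet_strip
    beta_reduce
    rw [Complex.real_smul, mul_comm]
  have hstrip : ∫ z in strip, γ z * ((laplacian (fun z => ψ z.1 * θ z.2) z
      + ω ^ 2 * (ψ z.1 * θ z.2) : ℝ) : ℂ)
      = ∫ z in strip, γ z * ((h z.1 * crossMode n z.2 : ℝ) : ℂ) :=
    setIntegral_congr_fun measurableSet_strip fun z hz => by
      rw [hlap z hz]
  rw [hstrip, strip, Measure.volume_eq_prod, setIntegral_prod _ hint]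
  refine setIntegral_congr_fun measurableSet_Iio fun x _ => ?_
  simp only [modeCoeff, hh]
  rw [← integral_mul_const]
  congr 1; ext y
  rw [Complex.real_smul]
  push_cast
  ring

/-- Test functions in the strip are real, whereas the potentials used for uniqueness are complex;
real and imaginary parts are treated separately and recombined. -/
lemma IsPointSourceSolution.integral_modeCoeff (hω : 0 < ω) (hωπ : ω < Real.pi)
    (hγ : IsPointSourceSolution ω p γ) (n : ℕ)
    {Ψ : ℝ → ℂ} (hΨ : ContDiff ℝ ((⊤ : ℕ∞) : WithTop ℕ∞) Ψ) (hΨc : HasCompactSupport Ψ)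
    (hΨ0 : deriv Ψ 0 = 0) :
    ∫ x in Iio (0 : ℝ), modeCoeff γ n x *
      (deriv (deriv Ψ) x - waveNumber ω n ^ 2 * Ψ x) = -Ψ p := by
  have hΨd := contDiff_infty_iff_deriv.mp hΨ
  have hΨdd := contDiff_infty_iff_deriv.mp hΨd.2
  have key : ∀ L : ℂ →L[ℝ] ℝ,
      IntegrableOn (fun x => modeCoeff γ n x * ((deriv (deriv fun x => L (Ψ x)) x
        - ((n * Real.pi) ^ 2 - ω ^ 2) * L (Ψ x) : ℝ) : ℂ)) (Iio 0) ∧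
      (∀ x, deriv (deriv fun x => L (Ψ x)) x = L (deriv (deriv Ψ) x)) ∧
      ∫ x in Iio (0 : ℝ), modeCoeff γ n x * ((deriv (deriv fun x => L (Ψ x)) x
        - ((n * Real.pi) ^ 2 - ω ^ 2) * L (Ψ x) : ℝ) : ℂ) = -(L (Ψ p) : ℂ) := by
    intro L
    have hs : ContDiff ℝ ((⊤ : ℕ∞) : WithTop ℕ∞) fun x => L (Ψ x) := L.contDiff.comp hΨ
    have hc : HasCompactSupport fun x => L (Ψ x) := hΨc.comp_left (map_zero L)
    have h1 : (deriv fun x => L (Ψ x)) = fun x => L (deriv Ψ x) := funext fun x =>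
      (L.hasFDerivAt.comp_hasDerivAt x (hΨd.1 x).hasDerivAt).deriv
    have h2 : ∀ x, deriv (deriv fun x => L (Ψ x)) x = L (deriv (deriv Ψ) x) := fun x => by
      rw [h1]
      exact (L.hasFDerivAt.comp_hasDerivAt x (hΨdd.1 x).hasDerivAt).deriv
    refine ⟨?_, h2, hγ.integral_modeCoeff_real n hs hc (by rw [h1]; simp [hΨ0])⟩
    obtain ⟨R, hR⟩ := hΨc.isCompact.isBounded.subset_closedBall 0
    refine integrableOn_mul_of_eq_zero (R := R + 1) (hγ.integrableOn_modeCoeff n _) ?_ fun x hx => ?_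
    · simp only [h2]
      exact Complex.continuous_ofReal.comp ((L.continuous.comp hΨdd.2.continuous).sub
        (continuous_const.mul (L.continuous.comp hΨ.continuous)))
    · have hx' : x ∉ tsupport Ψ := fun h => by
        have h3 := hR h
        rw [Metric.mem_closedBall, dist_zero_right, Real.norm_eq_abs] at h3
        linarith [(abs_le.mp h3).1]
      have hx'' : x ∉ tsupport (deriv (deriv Ψ)) := fun h =>
        hx' (tsupport_deriv_subset (tsupport_deriv_subset h))
      rw [h2, image_eq_zero_of_notMem_tsupport hx', image_eq_zero_of_notMem_tsupport hx'']
      simp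
  obtain ⟨i1, d1, e1⟩ := key Complex.reCLM
  obtain ⟨i2, d2, e2⟩ := key Complex.imCLM
  have hsum := integral_add i1 (i2.mul_const Complex.I)
  rw [integral_mul_const, e1, e2] at hsum
  have hp : -(Complex.reCLM (Ψ p) : ℂ) + -(Complex.imCLM (Ψ p) : ℂ) * Complex.I = -Ψ p := by
    have := Complex.re_add_im (Ψ p)
    simp only [Complex.reCLM_apply, Complex.imCLM_apply]
    linear_combination -this
  rw [hp] at hsum
  rw [← hsum]
  congr 1; ext x
  rw [d1, d2, waveNumber_sq hω hωπ]
  have r1 := Complex.re_add_im (Ψ x)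
  have r2 := Complex.re_add_im (deriv (deriv Ψ) x)
  simp only [Complex.reCLM_apply, Complex.imCLM_apply]
  push_cast
  linear_combination modeCoeff γ n x * (((n * Real.pi) ^ 2 - ω ^ 2) * r1 - r2)

lemma integral_crossMode (n : ℕ) :
    ∫ y in Ioo (0 : ℝ) 1, crossMode n y = if n = 0 then 1 else 0 := by
  have h := integral_crossMode_mul_crossMode n 0
  simpa [crossMode] using h

/-- The plane wave is constant in `y`, so by orthogonality it is seen only by the coefficient `n =
0`. -/
lemma IsPointSourceSolution.norm_modeCoeff_sub_le (hγ : IsPointSourceSolution ω p γ) {s : ℂ}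
    (hs : HasAmplitude ω γ s) (n : ℕ) : ∃ α > 0, ∃ C x₀ : ℝ, ∀ᵐ x : ℝ, x < 0 → x ≤ x₀ →
      ‖modeCoeff γ n x - (if n = 0 then s else 0) * Complex.exp (waveNumber ω n * x)‖
        ≤ C * Real.exp (α * x) := by
  obtain ⟨α, hα, C, x₀, hC⟩ := hs
  refine ⟨α, hα, C, x₀, ?_⟩
  filter_upwards [hγ.integrable_slice] with x hx hx0 hxx₀
  have hi1 := integrable_smul_of_bounded (hx hx0) (continuous_crossMode n).aestronglyMeasurable 1
    (abs_crossMode_le_one n)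
  have hi2 : IntegrableOn (fun y => (crossMode n y : ℂ) * (s * outgoingMode ω (x, 0)))
      (Ioo 0 1) := by
    refine ((Continuous.integrableOn_Icc ?_).mono_set Ioo_subset_Icc_self)
    have := continuous_crossMode n
    fun_prop
  have hsub := integral_sub hi1 hi2
  have heq : (if n = 0 then s else 0) * Complex.exp (waveNumber ω n * x)
      = ∫ y in Ioo (0 : ℝ) 1, (crossMode n y : ℂ) * (s * outgoingMode ω (x, 0)) := by
    rw [integral_mul_const, integral_complex_ofReal, integral_crossMode]
    by_cases hn : n = 0
    · simp [hn, waveNumber, outgoingMode]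
    · simp [hn]
  rw [heq, modeCoeff, ← hsub]
  refine (norm_integral_le_of_norm_le_const (C := C * Real.exp (α * x)) ?_).trans (by simp)
  filter_upwards [ae_restrict_mem measurableSet_Ioo] with y hy
  have h1 : crossMode n y • γ (x, y) - (crossMode n y : ℂ) * (s * outgoingMode ω (x, 0))
      = crossMode n y • (γ (x, y) - s * outgoingMode ω (x, y)) := by
    rw [Complex.real_smul, Complex.real_smul]
    simp only [outgoingMode]
    ring
  rw [h1, norm_smul]
  exact (mul_le_of_le_one_left (norm_nonneg _) (abs_crossMode_le_one n y)).trans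
    (hC (x, y) ⟨hx0, hy⟩ hxx₀)

theorem IsPointSourceSolution.modeCoeff_ae_eq (hω : 0 < ω) (hωπ : ω < Real.pi) (hp : p < 0)
    (hγ : IsPointSourceSolution ω p γ) {s : ℂ} (hs : HasAmplitude ω γ s) (n : ℕ) :
    ∀ᵐ x : ℝ, x < 0 → modeCoeff γ n x = modeGreen (waveNumber ω n) p x := by
  obtain ⟨α, hα, C, x₀, hC⟩ := hγ.norm_modeCoeff_sub_le hs n
  exact ae_eq_modeGreen (waveNumber_ne_zero hω hωπ n) (waveNumber_re_nonneg ω n) hp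
    (hγ.integrableOn_modeCoeff n) hα hC fun Ψ h1 h2 h3 => hγ.integral_modeCoeff hω hωπ n h1 h2 h3

/-- The amplitude of an outgoing solution. -/
theorem IsPointSourceSolution.eq_of_hasAmplitude (hω : 0 < ω) (hωπ : ω < Real.pi) (hp : p < 0)
    (hγ : IsPointSourceSolution ω p γ) {s : ℂ} (hs : HasAmplitude ω γ s) :
    s = Complex.I * Real.cos (ω * p) / ω := by
  obtain ⟨α, hα, C, x₀, hC⟩ := hγ.norm_modeCoeff_sub_le hs 0
  have hω' : (ω : ℂ) ≠ 0 := by exact_mod_cast hω.ne'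
  -- For `x < p` the coefficient `n = 0` is exactly `(i cos(ωp) / ω) e^{-iωx}`, and `|e^{-iωx}| =
  -- 1`, so the constant difference of the amplitudes is bounded by a decaying exponential.
  have hae : ∀ᵐ x : ℝ, x < min x₀ p →
      ‖Complex.I * Real.cos (ω * p) / ω - s‖ ≤ C * Real.exp (α * x) := by
    filter_upwards [hC, hγ.modeCoeff_ae_eq hω hωπ hp hs 0] with x h1 h2 hx
    have hxp := hx.trans_le (min_le_right _ _)
    have h3 := h1 (hxp.trans hp) (hx.trans_le (min_le_left _ _)).le
    rw [h2 (hxp.trans hp), modeGreen_of_le hp hxp.le] at h3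
    have h4 : Complex.cosh (waveNumber ω 0 * p) / waveNumber ω 0
        = Complex.I * Real.cos (ω * p) / ω := by
      simp only [waveNumber, if_true]
      rw [show -(Complex.I * ω) * (p : ℂ) = (-(ω * p)) * Complex.I by ring, Complex.cosh_mul_I,
        Complex.cos_neg]
      push_cast
      field_simp
      rw [Complex.I_sq]
      ring
    have h5 : ‖Complex.exp (waveNumber ω 0 * x)‖ = 1 := by
      simp [waveNumber, Complex.norm_exp]
    rw [if_pos rfl, mul_div_right_comm, h4, ← sub_mul, norm_mul, h5, mul_one] at h3
    exact h3
  have hlim : Tendsto (fun x : ℝ => C * Real.exp (α * x)) atBot (𝓝 0) := by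
    simpa using (Real.tendsto_exp_atBot.comp
      (tendsto_id.const_mul_atBot hα)).const_mul C
  -- The bound holds almost everywhere only, but half-lines have positive measure, so it holds at
  -- points arbitrarily far to the left.
  have hfreq : ∃ᶠ x : ℝ in atBot, ‖Complex.I * Real.cos (ω * p) / ω - s‖ ≤ C * Real.exp (α * x) := by
    rw [frequently_atBot]
    intro b
    by_contra! hcon
    have hz : volume (Iio (min b (min x₀ p))) = 0 := by
      refine measure_mono_null (fun x hx => ?_) (ae_iff.mp hae)
      have hx' : x < min b (min x₀ p) := hx
      simp only [mem_ofPred_eq, Classical.not_imp, not_le]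
      exact ⟨hx'.trans_le (min_le_right _ _), hcon x (hx'.trans_le (min_le_left _ _)).le⟩
    simp at hz
  have h0 : ‖Complex.I * Real.cos (ω * p) / ω - s‖ ≤ 0 :=
    ge_of_tendsto_of_frequently hlim hfreq
  exact (sub_eq_zero.mp (norm_le_zero_iff.mp h0)).symm

end coefficients

/-! ### Comparison of the evanescent modes with those at zero frequency -/

/-- The longitudinal decay rate of the `(n + 1)`-st mode. -/
noncomputable def decayRate (ω : ℝ) (n : ℕ) : ℝ := √(((n + 1 : ℕ) * Real.pi) ^ 2 - ω ^ 2)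

/-- The frequency of the `(n + 1)`-st mode of the cross-section. -/
noncomputable def crossFreq (n : ℕ) : ℝ := (n + 1 : ℕ) * Real.pi

/-- The relative difference between `crossFreq` and `decayRate`. -/
noncomputable def rateDefect (ω : ℝ) (n : ℕ) : ℝ := (crossFreq n - decayRate ω n) / decayRate ω n

lemma pi_le_crossFreq (n : ℕ) : Real.pi ≤ crossFreq n := by
  have h1 : (1 : ℝ) ≤ (n + 1 : ℕ) := by exact_mod_cast Nat.le_add_left 1 n
  exact le_mul_of_one_le_left Real.pi_pos.le h1

lemma crossFreq_pos (n : ℕ) : 0 < crossFreq n := Real.pi_pos.trans_le (pi_le_crossFreq n)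

section

variable {ω : ℝ}

lemma decayRate_pos (hω : 0 < ω) (hωπ : ω < Real.pi) (n : ℕ) : 0 < decayRate ω n :=
  Real.sqrt_pos.mpr (sub_pos.mpr (sq_lt_sq_mul_pi hω hωπ n.succ_ne_zero))

lemma decayRate_sq (hω : 0 < ω) (hωπ : ω < Real.pi) (n : ℕ) :
    decayRate ω n ^ 2 = crossFreq n ^ 2 - ω ^ 2 :=
  Real.sq_sqrt (sub_nonneg.mpr (sq_lt_sq_mul_pi hω hωπ n.succ_ne_zero).le)

lemma decayRate_le_crossFreq (hω : 0 < ω) (hωπ : ω < Real.pi) (n : ℕ) :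
    decayRate ω n ≤ crossFreq n := by
  refine le_of_sq_le_sq ?_ (crossFreq_pos n).le
  rw [decayRate_sq hω hωπ]
  linarith [sq_nonneg ω]

lemma rateDefect_nonneg (hω : 0 < ω) (hωπ : ω < Real.pi) (n : ℕ) : 0 ≤ rateDefect ω n :=
  div_nonneg (sub_nonneg.mpr (decayRate_le_crossFreq hω hωπ n)) (decayRate_pos hω hωπ n).le

/-- With `K = crossFreq n` and `κ = decayRate ω n`, the defect is `ω² / (κ(K + κ))`. Since `K ≥ π`,
one has `κ ≥ cK` with `c² = 1 - (ω/π)²`, and the defect is `O(1/n²)`. -/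
lemma summable_rateDefect (hω : 0 < ω) (hωπ : ω < Real.pi) : Summable (rateDefect ω) := by
  set c := √(1 - (ω / Real.pi) ^ 2) with hc
  have hωπ1 : (ω / Real.pi) ^ 2 < 1 := by
    rw [sq_lt_one_iff₀ (by positivity)]
    exact (div_lt_one Real.pi_pos).mpr hωπ
  have hc0 : 0 < c := Real.sqrt_pos.mpr (by linarith)
  have hs : Summable fun n : ℕ => ω ^ 2 / (c * Real.pi ^ 2) * (1 / ((n + 1 : ℕ) : ℝ) ^ 2) :=
    ((summable_nat_add_iff 1).mpr (Real.summable_one_div_nat_pow.mpr one_lt_two)).mul_left _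
  refine Summable.of_nonneg_of_le (rateDefect_nonneg hω hωπ) (fun n => ?_) hs
  have hκ := decayRate_pos hω hωπ n
  have hK := crossFreq_pos n
  have hsq := decayRate_sq hω hωπ n
  have hcκ : c * crossFreq n ≤ decayRate ω n := by
    refine le_of_sq_le_sq ?_ hκ.le
    rw [mul_pow, hc, Real.sq_sqrt (by linarith), hsq, sub_mul, one_mul]
    have h1 : Real.pi ^ 2 ≤ crossFreq n ^ 2 :=
      pow_le_pow_left₀ Real.pi_pos.le (pi_le_crossFreq n) 2
    have h2 : (ω / Real.pi) ^ 2 * Real.pi ^ 2 = ω ^ 2 := by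
      rw [← mul_pow, div_mul_cancel₀ _ Real.pi_ne_zero]
    have h3 := mul_le_mul_of_nonneg_left h1 (sq_nonneg (ω / Real.pi))
    linarith
  have e1 : rateDefect ω n = ω ^ 2 / (decayRate ω n * (crossFreq n + decayRate ω n)) := by
    rw [rateDefect, div_eq_div_iff hκ.ne' (by positivity)]
    linear_combination (-decayRate ω n) * hsq
  have e2 : ω ^ 2 / (c * Real.pi ^ 2) * (1 / ((n + 1 : ℕ) : ℝ) ^ 2)
      = ω ^ 2 / ((c * crossFreq n) * crossFreq n) := by
    rw [crossFreq]
    field_simp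
  rw [e1, e2]
  refine div_le_div_of_nonneg_left (sq_nonneg ω) (by positivity) ?_
  exact mul_le_mul hcκ (by linarith) hK.le hκ.le

/-- The difference between the `(n + 1)`-st mode of the strip and its counterpart at zero
frequency. -/
noncomputable def corrFactor (ω : ℝ) (n : ℕ) (t : ℝ) : ℝ :=
  Real.exp (-(decayRate ω n * t)) / decayRate ω n - Real.exp (-(crossFreq n * t)) / crossFreq n

/-- The difference is at most `e^{-κt} (K - κ) t`, and `κt e^{-κt} ≤ 1` makes this uniform in `t`.
-/
lemma abs_exp_sub_exp_le (hω : 0 < ω) (hωπ : ω < Real.pi) (n : ℕ) {t : ℝ} (ht : 0 ≤ t) :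
    |Real.exp (-(decayRate ω n * t)) - Real.exp (-(crossFreq n * t))| ≤ rateDefect ω n := by
  have hκ := decayRate_pos hω hωπ n
  have hle := decayRate_le_crossFreq hω hωπ n
  have h0 : Real.exp (-(crossFreq n * t)) ≤ Real.exp (-(decayRate ω n * t)) :=
    Real.exp_le_exp.mpr (neg_le_neg (mul_le_mul_of_nonneg_right hle ht))
  rw [abs_of_nonneg (sub_nonneg.mpr h0), rateDefect, le_div_iff₀ hκ]
  have h1 : Real.exp (-(crossFreq n * t)) = Real.exp (-(decayRate ω n * t))
      * Real.exp (-((crossFreq n - decayRate ω n) * t)) := by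
    rw [← Real.exp_add]; congr 1; ring
  have h2 := Real.add_one_le_exp (-((crossFreq n - decayRate ω n) * t))
  have h3 := Real.add_one_le_exp (decayRate ω n * t)
  have h4 : Real.exp (-(decayRate ω n * t)) * Real.exp (decayRate ω n * t) = 1 := by
    rw [← Real.exp_add]; simp
  have h5 := Real.exp_pos (-(decayRate ω n * t))
  have h6 : Real.exp (-(decayRate ω n * t)) * (decayRate ω n * t) ≤ 1 := by
    rw [← h4]
    exact mul_le_mul_of_nonneg_left (by linarith) h5.le
  rw [h1]
  calc (Real.exp (-(decayRate ω n * t)) - Real.exp (-(decayRate ω n * t))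
        * Real.exp (-((crossFreq n - decayRate ω n) * t))) * decayRate ω n
      = Real.exp (-(decayRate ω n * t)) * decayRate ω n
        * (1 - Real.exp (-((crossFreq n - decayRate ω n) * t))) := by ring
    _ ≤ Real.exp (-(decayRate ω n * t)) * decayRate ω n * ((crossFreq n - decayRate ω n) * t) :=
        mul_le_mul_of_nonneg_left (by linarith) (by positivity)
    _ = Real.exp (-(decayRate ω n * t)) * (decayRate ω n * t)
        * (crossFreq n - decayRate ω n) := by ring
    _ ≤ 1 * (crossFreq n - decayRate ω n) :=
        mul_le_mul_of_nonneg_right h6 (sub_nonneg.mpr hle)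
    _ = _ := one_mul _

/-- The extra factor `K` is what differentiation of `cos(Ku)` in `u` costs. -/
lemma abs_corrFactor_le (hω : 0 < ω) (hωπ : ω < Real.pi) (n : ℕ) {t : ℝ} (ht : 0 ≤ t) :
    |corrFactor ω n t| * crossFreq n ≤ 2 * rateDefect ω n := by
  have hκ := decayRate_pos hω hωπ n
  have hK := crossFreq_pos n
  have h1 := abs_exp_sub_exp_le hω hωπ n ht
  have h2 : Real.exp (-(decayRate ω n * t)) ≤ 1 := Real.exp_le_one_iff.mpr
    (neg_nonpos.mpr (by positivity))
  have e : corrFactor ω n t * crossFreq n = Real.exp (-(decayRate ω n * t)) * rateDefect ω n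
      + (Real.exp (-(decayRate ω n * t)) - Real.exp (-(crossFreq n * t))) := by
    rw [corrFactor, rateDefect]
    field_simp
    ring
  have hr := rateDefect_nonneg hω hωπ n
  rw [← abs_of_pos hK, ← abs_mul, e]
  refine (abs_add_le _ _).trans ?_
  rw [abs_of_nonneg (by positivity)]
  nlinarith [mul_le_mul_of_nonneg_right h2 hr]

lemma abs_corrFactor_sub_le (hω : 0 < ω) (hωπ : ω < Real.pi) (n : ℕ) {t t' : ℝ} (ht : 0 ≤ t)
    (ht' : 0 ≤ t') : |corrFactor ω n t - corrFactor ω n t'| ≤ rateDefect ω n * |t - t'| := by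
  have hκ := decayRate_pos hω hωπ n
  have hK := crossFreq_pos n
  have hexp : ∀ (a : ℝ), a ≠ 0 → ∀ t : ℝ, HasDerivAt (fun t => Real.exp (-(a * t)) / a)
      (-Real.exp (-(a * t))) t := by
    intro a ha t
    have h := ((((hasDerivAt_id t).const_mul a).neg).exp).div_const a
    refine h.congr_deriv ?_
    simp only [id, Pi.neg_apply]
    field_simp
  have hd : ∀ t, HasDerivAt (corrFactor ω n)
      (-(Real.exp (-(decayRate ω n * t)) - Real.exp (-(crossFreq n * t)))) t := fun t =>
    ((hexp _ hκ.ne' t).sub (hexp _ hK.ne' t)).congr_deriv (by ring)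
  have := (convex_Ici (0 : ℝ)).norm_image_sub_le_of_norm_hasDerivWithin_le
    (f := corrFactor ω n) (C := rateDefect ω n) (fun x _ => (hd x).hasDerivWithinAt)
    (fun x hx => by rw [norm_neg]; exact abs_exp_sub_exp_le hω hωπ n hx) ht' ht
  simpa only [Real.norm_eq_abs] using this

/-- The part of the profile of the Green function that is Lipschitz up to the pole. -/
noncomputable def corr (ω t u : ℝ) : ℝ := ∑' n, Real.cos (crossFreq n * u) * corrFactor ω n t

lemma summable_corr (hω : 0 < ω) (hωπ : ω < Real.pi) {t : ℝ} (ht : 0 ≤ t) (u : ℝ) :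
    Summable fun n => Real.cos (crossFreq n * u) * corrFactor ω n t := by
  refine Summable.of_norm_bounded ((summable_rateDefect hω hωπ).mul_left 2) fun n => ?_
  rw [Real.norm_eq_abs, abs_mul]
  refine (mul_le_of_le_one_left (abs_nonneg _) (Real.abs_cos_le_one _)).trans
    ((le_mul_of_one_le_right (abs_nonneg _) ?_).trans (abs_corrFactor_le hω hωπ n ht))
  linarith [pi_le_crossFreq n, Real.pi_gt_three]

/-- Termwise Lipschitz bounds, in `t` by `abs_corrFactor_sub_le` and in `u` by `abs_corrFactor_le`,
are summable. They hold down to `t = 0`, that is, up to the pole. -/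
lemma abs_corr_sub_le (hω : 0 < ω) (hωπ : ω < Real.pi) {t t' : ℝ} (ht : 0 ≤ t) (ht' : 0 ≤ t')
    (u u' : ℝ) : |corr ω t u - corr ω t' u'|
      ≤ (2 * ∑' n, rateDefect ω n) * (|t - t'| + |u - u'|) := by
  rw [corr, corr, ← (summable_corr hω hωπ ht u).tsum_sub (summable_corr hω hωπ ht' u'),
    ← tsum_mul_left, ← tsum_mul_right, ← Real.norm_eq_abs]
  refine tsum_of_norm_bounded
    (((summable_rateDefect hω hωπ).mul_left 2).mul_right _).hasSum fun n => ?_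
  have h1 := abs_corrFactor_sub_le hω hωπ n ht ht'
  have h2 := abs_corrFactor_le hω hωπ n ht'
  have h3 : |Real.cos (crossFreq n * u) - Real.cos (crossFreq n * u')| ≤ crossFreq n * |u - u'| := by
    refine (Real.abs_cos_sub_cos_le _ _).trans_eq ?_
    rw [← mul_sub, abs_mul, abs_of_pos (crossFreq_pos n)]
  have hr := rateDefect_nonneg hω hωπ n
  have e : Real.cos (crossFreq n * u) * corrFactor ω n t
      - Real.cos (crossFreq n * u') * corrFactor ω n t'
      = Real.cos (crossFreq n * u) * (corrFactor ω n t - corrFactor ω n t')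
        + (Real.cos (crossFreq n * u) - Real.cos (crossFreq n * u')) * corrFactor ω n t' := by ring
  rw [e, Real.norm_eq_abs]
  refine (abs_add_le _ _).trans ?_
  rw [abs_mul, abs_mul]
  have h4 := mul_le_of_le_one_left (abs_nonneg (corrFactor ω n t - corrFactor ω n t'))
    (Real.abs_cos_le_one (crossFreq n * u))
  have h5 := mul_le_mul_of_nonneg_right h3 (abs_nonneg (corrFactor ω n t'))
  have h6 := mul_le_mul_of_nonneg_right h2 (abs_nonneg (u - u'))
  have h7 := mul_nonneg hr (abs_nonneg (t - t'))
  nlinarith [h4, h5, h6, h7]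

/-! ### The Green function of the infinite strip -/

/-- The singular part of the profile of the Green function. -/
noncomputable def logPart (t u : ℝ) : ℝ :=
  -(1 / Real.pi * Real.log ‖1 - Complex.exp (Real.pi * (-t + Complex.I * u))‖)

/-- Real part of the Taylor series of `-log(1 - w)` at `w = e^{π(-t + iu)}`, `|w| < 1`. -/
lemma hasSum_logPart {t : ℝ} (ht : 0 < t) (u : ℝ) :
    HasSum (fun n => Real.cos (crossFreq n * u) * (Real.exp (-(crossFreq n * t)) / crossFreq n))
      (logPart t u) := by
  have hn : ‖Complex.exp (Real.pi * (-t + Complex.I * u))‖ < 1 := by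
    rw [Complex.norm_exp, Real.exp_lt_one_iff]
    simp only [Complex.mul_re, Complex.add_re, Complex.neg_re, Complex.ofReal_re, Complex.I_re,
      Complex.I_im, Complex.ofReal_im, zero_mul, mul_zero, sub_zero, add_zero]
    nlinarith [Real.pi_pos]
  have h := (Complex.hasSum_re (Complex.hasSum_taylorSeries_neg_log' hn)).mul_left (1 / Real.pi)
  have e : 1 / Real.pi * (-Complex.log (1 - Complex.exp (Real.pi * (-t + Complex.I * u)))).re
      = logPart t u := by
    rw [Complex.neg_re, Complex.log_re, logPart]
    ring
  rw [e] at h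
  refine h.congr_fun fun n => ?_
  rw [← Complex.exp_nat_mul]
  have e2 : ((n + 1 : ℕ) : ℂ) * (Real.pi * (-t + Complex.I * u))
      = ((-(crossFreq n * t) : ℝ) : ℂ) + ((crossFreq n * u : ℝ) : ℂ) * Complex.I := by
    rw [crossFreq]; push_cast; ring
  have e3 : ((n : ℂ) + 1) = (((n + 1 : ℕ) : ℝ) : ℂ) := by push_cast; rfl
  rw [e2, e3, Complex.div_ofReal_re, Complex.exp_add, ← Complex.ofReal_exp,
    Complex.re_ofReal_mul, Complex.exp_ofReal_mul_I_re, crossFreq]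
  field_simp

/-- The Green function of the doubly infinite strip with pole at the upper side, in terms of the
distances `t` to the cross-section of the pole and `u` to the upper side. -/
noncomputable def profile (ω t u : ℝ) : ℂ :=
  Complex.I * Complex.exp (Complex.I * ω * t) / (2 * ω) + ((logPart t u + corr ω t u : ℝ) : ℂ)

lemma profile_im (ω t u : ℝ) : (profile ω t u).im = Real.cos (ω * t) / (2 * ω) := by
  have e : Complex.I * Complex.exp (Complex.I * ω * t) / (2 * ω)
      = Complex.I * Complex.exp (((ω * t : ℝ) : ℂ) * Complex.I) / ((2 * ω : ℝ) : ℂ) := by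
    push_cast
    ring_nf
  rw [profile, e, Complex.add_im, Complex.ofReal_im, add_zero, Complex.div_ofReal_im,
    Complex.I_mul_im, Complex.exp_ofReal_mul_I_re]

/-- The coefficients of `profile` in the modes of the cross-section. -/
noncomputable def profileCoeff (ω t : ℝ) (n : ℕ) : ℂ :=
  Complex.exp (-waveNumber ω n * t) / (2 * waveNumber ω n)

/-- The weights `1` and `2` are the inverse squared norms of the modes on `(0, 1)`. For `n ≥ 1` the
term `e^{-κt}/κ` is the sum of its parts in `logPart` and `corr`. -/
lemma hasSum_profile (hω : 0 < ω) (hωπ : ω < Real.pi) {t : ℝ} (ht : 0 < t) (u : ℝ) :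
    HasSum (fun n : ℕ => (if n = 0 then 1 else 2) * profileCoeff ω t n
      * (Real.cos (n * Real.pi * u) : ℂ)) (profile ω t u) := by
  rw [← hasSum_nat_add_iff' 1]
  have h := Complex.hasSum_ofReal.mpr ((hasSum_logPart ht u).add
    (summable_corr hω hωπ ht.le u).hasSum)
  have hω' : (ω : ℂ) ≠ 0 := by exact_mod_cast hω.ne'
  have e : profile ω t u - ∑ n ∈ Finset.range 1, (if n = 0 then 1 else 2) * profileCoeff ω t n
      * (Real.cos (n * Real.pi * u) : ℂ) = ((logPart t u + corr ω t u : ℝ) : ℂ) := by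
    rw [Finset.sum_range_one, if_pos rfl, profileCoeff, waveNumber, if_pos rfl, profile]
    simp only [Nat.cast_zero, zero_mul, Real.cos_zero, Complex.ofReal_one, neg_neg]
    field_simp
    linear_combination Complex.exp (Complex.I * ω * t) * Complex.I_mul_I
  rw [e]
  refine h.congr_fun fun n => ?_
  have hκ : (decayRate ω n : ℂ) ≠ 0 := by exact_mod_cast (decayRate_pos hω hωπ n).ne'
  rw [if_neg n.succ_ne_zero, profileCoeff, waveNumber, if_neg n.succ_ne_zero]
  change 2 * (Complex.exp (-(decayRate ω n : ℂ) * t) / (2 * (decayRate ω n : ℂ)))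
    * (Real.cos (crossFreq n * u) : ℂ) = _
  rw [← mul_add, corrFactor, add_sub_cancel]
  push_cast
  rw [neg_mul]
  field_simp

/-- At `u = 0` all cosines are `1`, and convergent families in `ℂ` converge absolutely. -/
lemma summable_norm_profileCoeff (hω : 0 < ω) (hωπ : ω < Real.pi) {t : ℝ} (ht : 0 < t) :
    Summable fun n : ℕ => ‖(if n = 0 then 1 else 2) * profileCoeff ω t n‖ := by
  have h := (hasSum_profile hω hωπ ht 0).summable.norm
  simpa using h

lemma continuous_profile_right (hω : 0 < ω) (hωπ : ω < Real.pi) {t : ℝ} (ht : 0 < t) :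
    Continuous fun y => profile ω t (1 - y) := by
  have h : (fun y => profile ω t (1 - y)) = fun y => ∑' n : ℕ, (if n = 0 then 1 else 2)
      * profileCoeff ω t n * (Real.cos (n * Real.pi * (1 - y)) : ℂ) :=
    funext fun y => (hasSum_profile hω hωπ ht (1 - y)).tsum_eq.symm
  rw [h]
  refine continuous_tsum (fun n => by fun_prop) (summable_norm_profileCoeff hω hωπ ht)
    fun n y => ?_
  rw [norm_mul]
  refine mul_le_of_le_one_right (norm_nonneg _) ?_
  rw [Complex.norm_real]
  exact Real.abs_cos_le_one _

lemma integral_crossMode_smul_profile (hω : 0 < ω) (hωπ : ω < Real.pi) {t : ℝ} (ht : 0 < t)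
    (n : ℕ) : ∫ y in Ioo (0 : ℝ) 1, crossMode n y • profile ω t (1 - y) = profileCoeff ω t n := by
  set a : ℕ → ℂ := fun m => (if m = 0 then 1 else 2) * profileCoeff ω t m with ha
  set F : ℕ → ℝ → ℂ := fun m y => a m * ((crossMode m y * crossMode n y : ℝ) : ℂ) with hF
  have hFc : ∀ m, Continuous (F m) := fun m => by
    have h1 := continuous_crossMode m
    have h2 := continuous_crossMode n
    simp only [hF]
    fun_prop
  have hFi : ∀ m, IntegrableOn (F m) (Ioo 0 1) := fun m =>
    (hFc m).integrableOn_Icc.mono_set Ioo_subset_Icc_self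
  have hFn : ∀ m y, ‖F m y‖ ≤ ‖a m‖ := fun m y => by
    simp only [hF]
    rw [norm_mul, Complex.norm_real]
    refine mul_le_of_le_one_right (norm_nonneg _) ?_
    rw [norm_mul]
    exact mul_le_one₀ (abs_crossMode_le_one m y) (norm_nonneg _) (abs_crossMode_le_one n y)
  have hFs : Summable fun m => ∫ y in Ioo (0 : ℝ) 1, ‖F m y‖ := by
    refine Summable.of_nonneg_of_le (fun m => integral_nonneg fun y => norm_nonneg _) (fun m => ?_)
      (summable_norm_profileCoeff hω hωπ ht)
    refine (integral_mono (hFi m).norm (integrable_const ‖a m‖) (hFn m)).trans_eq ?_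
    simp [ha]
  have h := hasSum_integral_of_summable_integral_norm hFi hFs
  have h1 : ∀ y, ∑' m, F m y = crossMode n y • profile ω t (1 - y) := fun y => by
    rw [← (hasSum_profile hω hωπ ht (1 - y)).tsum_eq, Complex.real_smul, ← tsum_mul_left]
    refine tsum_congr fun m => ?_
    simp only [hF, ha, crossMode]
    push_cast
    ring
  simp_rw [h1] at h
  have h2 : ∀ m, ∫ y in Ioo (0 : ℝ) 1, F m y = if m = n then profileCoeff ω t n else 0 := by
    intro m
    simp only [hF]
    rw [integral_const_mul, integral_complex_ofReal, integral_crossMode_mul_crossMode]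
    by_cases hmn : m = n
    · subst hmn
      by_cases hm : m = 0
      · simp [ha, hm]
      · simp only [ha, hm, if_true, if_false]
        push_cast
        ring
    · simp [hmn]
  simp_rw [h2] at h
  exact h.unique (hasSum_ite_eq n _)

end

/-! ### The Green function of the half-strip: regularity, singularity, imaginary part -/

open Asymptotics

section

variable {ω p : ℝ}

/-- The Green function of the half-strip with pole `(p, 1)`, by reflection in the short side. -/
noncomputable def green (ω p : ℝ) (z : ℝ × ℝ) : ℂ :=
  profile ω |z.1 - p| (1 - z.2) + profile ω |z.1 + p| (1 - z.2)

/-- `logPart` is regular where this function does not vanish. -/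
noncomputable def logArg (t u : ℝ) : ℂ := 1 - Complex.exp (Real.pi * (-t + Complex.I * u))

lemma logArg_ne_zero_of_pos {t : ℝ} (ht : 0 < t) (u : ℝ) : logArg t u ≠ 0 := by
  intro h
  have h1 : ‖Complex.exp (Real.pi * (-t + Complex.I * u))‖ = 1 := by
    rw [← sub_eq_zero.mp h, norm_one]
  rw [Complex.norm_exp, Real.exp_eq_one_iff] at h1
  simp only [Complex.mul_re, Complex.add_re, Complex.neg_re, Complex.ofReal_re, Complex.I_re,
      Complex.I_im, Complex.ofReal_im, zero_mul, mul_zero, sub_zero, add_zero] at h1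
  nlinarith [Real.pi_pos]

/-- Covers the cross-section of the pole, where `t = 0`: the exponential has argument `πu` in `(0,
π)` and is not real. -/
lemma logArg_ne_zero_of_mem_Ioo (t : ℝ) {u : ℝ} (hu : u ∈ Ioo (0 : ℝ) 1) : logArg t u ≠ 0 := by
  intro h
  have h1 : (Complex.exp (Real.pi * (-t + Complex.I * u))).im = 0 := by
    rw [← sub_eq_zero.mp h, Complex.one_im]
  rw [Complex.exp_im, mul_eq_zero] at h1
  have h2 : ((Real.pi : ℂ) * (-t + Complex.I * u)).im = Real.pi * u := by simp
  rw [h2] at h1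
  rcases h1 with h1 | h1
  · exact (Real.exp_pos _).ne' h1
  · exact (Real.sin_pos_of_pos_of_lt_pi (mul_pos Real.pi_pos hu.1)
      (mul_lt_of_lt_one_right Real.pi_pos hu.2)).ne' h1

/-- The Lipschitz part of the Green function. -/
lemma abs_corr_comp_sub_le (hω : 0 < ω) (hωπ : ω < Real.pi) (q : ℝ) (z w : ℝ × ℝ) :
    |corr ω |z.1 - q| (1 - z.2) - corr ω |w.1 - q| (1 - w.2)|
      ≤ (2 * (2 * ∑' n, rateDefect ω n)) * ‖z - w‖ := by
  refine (abs_corr_sub_le hω hωπ (abs_nonneg _) (abs_nonneg _) _ _).trans ?_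
  have h0 : 0 ≤ ∑' n, rateDefect ω n := tsum_nonneg (rateDefect_nonneg hω hωπ)
  have h1 : |(|z.1 - q| - |w.1 - q|)| ≤ ‖z - w‖ := by
    refine (abs_abs_sub_abs_le_abs_sub _ _).trans ?_
    rw [sub_sub_sub_cancel_right]
    exact norm_fst_le (z - w)
  have h2 : |1 - z.2 - (1 - w.2)| ≤ ‖z - w‖ := by
    rw [sub_sub_sub_cancel_left, abs_sub_comm]
    exact norm_snd_le (z - w)
  calc (2 * ∑' n, rateDefect ω n) * (|(|z.1 - q| - |w.1 - q|)| + |1 - z.2 - (1 - w.2)|)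
      ≤ (2 * ∑' n, rateDefect ω n) * (‖z - w‖ + ‖z - w‖) :=
        mul_le_mul_of_nonneg_left (add_le_add h1 h2) (by positivity)
    _ = _ := by ring

lemma isBigO_corr_comp (hω : 0 < ω) (hωπ : ω < Real.pi) (q : ℝ) (w : ℝ × ℝ) :
    (fun z : ℝ × ℝ => ((corr ω |z.1 - q| (1 - z.2) - corr ω |w.1 - q| (1 - w.2) : ℝ) : ℂ))
      =O[𝓝 w] fun z => z - w :=
  IsBigO.of_bound _ (Eventually.of_forall fun z => by
    rw [Complex.norm_real]; exact abs_corr_comp_sub_le hω hωπ q z w)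

lemma continuous_corr_comp (hω : 0 < ω) (hωπ : ω < Real.pi) (q : ℝ) :
    Continuous fun z : ℝ × ℝ => corr ω |z.1 - q| (1 - z.2) := by
  have h : LipschitzWith (2 * (2 * ∑' n, rateDefect ω n)).toNNReal
      fun z : ℝ × ℝ => corr ω |z.1 - q| (1 - z.2) := by
    refine LipschitzWith.of_dist_le' fun z w => ?_
    rw [Real.dist_eq, dist_eq_norm]
    exact abs_corr_comp_sub_le hω hωπ q z w
  exact h.continuous

lemma continuousAt_profile_comp (hω : 0 < ω) (hωπ : ω < Real.pi) (q : ℝ) {w : ℝ × ℝ}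
    (hw : logArg |w.1 - q| (1 - w.2) ≠ 0) :
    ContinuousAt (fun z : ℝ × ℝ => profile ω |z.1 - q| (1 - z.2)) w := by
  have h1 : ContinuousAt (fun z : ℝ × ℝ => logArg |z.1 - q| (1 - z.2)) w := by
    unfold logArg
    fun_prop
  have h2 : ContinuousAt (fun z : ℝ × ℝ => logPart |z.1 - q| (1 - z.2)) w :=
    ((h1.norm.log (norm_ne_zero_iff.mpr hw)).const_mul (1 / Real.pi)).neg
  have h3 := (continuous_corr_comp hω hωπ q).continuousAt (x := w)
  have h4 : ContinuousAt (fun z : ℝ × ℝ =>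
      Complex.I * Complex.exp (Complex.I * ω * (|z.1 - q| : ℝ)) / (2 * ω)) w := by
    fun_prop
  exact h4.add (Complex.continuous_ofReal.continuousAt.comp (h2.add h3))

lemma isBigO_profile_comp (hω : 0 < ω) (hωπ : ω < Real.pi) {q : ℝ} {w : ℝ × ℝ} (hw : w.1 ≠ q) :
    (fun z : ℝ × ℝ => profile ω |z.1 - q| (1 - z.2) - profile ω |w.1 - q| (1 - w.2))
      =O[𝓝 w] fun z => z - w := by
  have habs : DifferentiableAt ℝ (fun z : ℝ × ℝ => |z.1 - q|) w :=
    (differentiableAt_fst.sub_const q).abs (sub_ne_zero.mpr hw)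
  have habsC : DifferentiableAt ℝ (fun z : ℝ × ℝ => ((|z.1 - q| : ℝ) : ℂ)) w :=
    Complex.ofRealCLM.differentiableAt.comp w habs
  have hu : DifferentiableAt ℝ (fun z : ℝ × ℝ => ((1 - z.2 : ℝ) : ℂ)) w :=
    Complex.ofRealCLM.differentiableAt.comp w (differentiableAt_snd.const_sub 1)
  have h1 : DifferentiableAt ℝ (fun z : ℝ × ℝ => logArg |z.1 - q| (1 - z.2)) w :=
    (((habsC.neg.add (hu.const_mul Complex.I)).const_mul (Real.pi : ℂ)).cexp).const_sub 1
  have h2 : DifferentiableAt ℝ (fun z : ℝ × ℝ => logPart |z.1 - q| (1 - z.2)) w :=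
    (((h1.norm ℝ (logArg_ne_zero_of_pos (abs_pos.mpr (sub_ne_zero.mpr hw)) _)).log
      (norm_ne_zero_iff.mpr (logArg_ne_zero_of_pos (abs_pos.mpr (sub_ne_zero.mpr hw)) _))).const_mul
      (1 / Real.pi)).neg
  have h3 : DifferentiableAt ℝ (fun z : ℝ × ℝ => Complex.I * Complex.exp (Complex.I * ω *
      (|z.1 - q| : ℝ)) / (2 * ω) + (logPart |z.1 - q| (1 - z.2) : ℂ)) w := by
    refine DifferentiableAt.add ?_ (Complex.ofRealCLM.differentiableAt.comp w h2)
    simp only [div_eq_mul_inv]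
    exact ((habsC.const_mul (Complex.I * ω)).cexp.const_mul Complex.I).mul_const _
  refine (h3.isBigO_sub.add (isBigO_corr_comp hω hωπ q w)).congr_left fun z => ?_
  simp only [profile]
  push_cast
  ring

/-- Writing `e^w - 1 = w(1 + v)` with `|v| ≤ |w|`, the left side is the absolute value of the real
part of `log(1 + v)`. -/
lemma abs_log_norm_one_sub_exp_sub_log_norm_le {w : ℂ} (hw0 : w ≠ 0) (hw : ‖w‖ ≤ 1 / 2) :
    |Real.log ‖1 - Complex.exp w‖ - Real.log ‖w‖| ≤ 3 / 2 * ‖w‖ := by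
  set v := (Complex.exp w - 1 - w) / w with hv
  have hwn : 0 < ‖w‖ := norm_pos_iff.mpr hw0
  have hvn : ‖v‖ ≤ ‖w‖ := by
    rw [hv, norm_div, div_le_iff₀ hwn, ← sq]
    exact Complex.norm_exp_sub_one_sub_id_le (hw.trans (by norm_num))
  have h1 : 1 - Complex.exp w = -(w * (1 + v)) := by
    rw [hv]; field_simp; ring
  have hv1 : 1 + v ≠ 0 := by
    intro h
    have : ‖v‖ = 1 := by rw [eq_neg_of_add_eq_zero_right h, norm_neg, norm_one]
    linarith
  rw [h1, norm_neg, norm_mul, Real.log_mul hwn.ne' (norm_ne_zero_iff.mpr hv1), add_sub_cancel_left,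
    ← Complex.log_re]
  refine (Complex.abs_re_le_norm _).trans ?_
  exact (Complex.norm_log_one_add_half_le_self (hvn.trans hw)).trans (by linarith)

/-- The scale `π` here produces the term `-log π / π` of `greenConstant`. -/
lemma dist₁_eq (p : ℝ) (z : ℝ × ℝ) :
    ‖(Real.pi : ℂ) * (-(|z.1 - p| : ℝ) + Complex.I * (1 - z.2 : ℝ))‖ = Real.pi * dist₁ p z := by
  rw [norm_mul, Complex.norm_real, Real.norm_of_nonneg Real.pi_pos.le, ← Complex.ofReal_neg,
    mul_comm Complex.I, Complex.norm_add_mul_I, dist₁, neg_sq, sq_abs]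
  congr 3
  ring

lemma norm_sub_le_dist₁ (p : ℝ) (z : ℝ × ℝ) : ‖z - (p, 1)‖ ≤ dist₁ p z := by
  rw [Prod.norm_def]
  refine max_le ?_ ?_ <;> refine Real.abs_le_sqrt ?_
  · exact le_add_of_nonneg_right (sq_nonneg _)
  · exact le_add_of_nonneg_left (sq_nonneg _)

lemma isBigO_sub_dist₁ (p : ℝ) (l : Filter (ℝ × ℝ)) :
    (fun z => z - (p, 1)) =O[l] dist₁ p :=
  IsBigO.of_bound 1 (Eventually.of_forall fun z => by
    rw [one_mul]
    exact (norm_sub_le_dist₁ p z).trans (le_abs_self _))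

lemma continuous_dist₁ (p : ℝ) : Continuous (dist₁ p) := by
  unfold dist₁; fun_prop

lemma dist₁_pos {p : ℝ} {z : ℝ × ℝ} (hz : z ∈ strip) : 0 < dist₁ p z :=
  Real.sqrt_pos.mpr (add_pos_of_nonneg_of_pos (sq_nonneg _)
    (sq_pos_iff.mpr (sub_ne_zero.mpr hz.2.2.ne)))

/-- The logarithmic singularity of the Green function. -/
lemma isBigO_logPart (p : ℝ) :
    (fun z : ℝ × ℝ => ((logPart |z.1 - p| (1 - z.2) - (1 / Real.pi * Real.log (1 / dist₁ p z)
      - Real.log Real.pi / Real.pi) : ℝ) : ℂ)) =O[𝓝[strip] (p, 1)] dist₁ p := by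
  have h0 : Tendsto (fun z => Real.pi * dist₁ p z) (𝓝[strip] (p, 1)) (𝓝 0) := by
    have h1 := ((continuous_dist₁ p).const_mul Real.pi).tendsto (p, 1)
    have h2 : Real.pi * dist₁ p (p, 1) = 0 := by simp [dist₁]
    rw [h2] at h1
    exact h1.mono_left nhdsWithin_le_nhds
  refine IsBigO.of_bound (3 / 2) ?_
  filter_upwards [h0.eventually_le_const (u := 1 / 2) (by norm_num), self_mem_nhdsWithin]
    with z hz hzs
  have hr := dist₁_pos (p := p) hzs
  have hn := dist₁_eq p z
  have hne : (Real.pi : ℂ) * (-(|z.1 - p| : ℝ) + Complex.I * (1 - z.2 : ℝ)) ≠ 0 := by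
    rw [← norm_ne_zero_iff, hn]
    exact (mul_pos Real.pi_pos hr).ne'
  have h := abs_log_norm_one_sub_exp_sub_log_norm_le hne (hn.trans_le hz)
  rw [hn, Real.log_mul Real.pi_ne_zero hr.ne'] at h
  have e : logPart |z.1 - p| (1 - z.2) - (1 / Real.pi * Real.log (1 / dist₁ p z)
      - Real.log Real.pi / Real.pi) = -(1 / Real.pi) * (Real.log ‖1 - Complex.exp
      (Real.pi * (-(|z.1 - p| : ℝ) + Complex.I * (1 - z.2 : ℝ)))‖
      - (Real.log Real.pi + Real.log (dist₁ p z))) := by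
    rw [logPart, one_div (dist₁ p z), Real.log_inv]
    ring
  rw [e, Complex.norm_real, norm_mul, norm_neg, Real.norm_of_nonneg (by positivity),
    Real.norm_of_nonneg hr.le, Real.norm_eq_abs]
  calc 1 / Real.pi * _ ≤ 1 / Real.pi * (3 / 2 * (Real.pi * dist₁ p z)) :=
        mul_le_mul_of_nonneg_left h (by positivity)
    _ = 3 / 2 * dist₁ p z := by field_simp

/-- The constant term of the Green function at its pole. -/
noncomputable def greenConstant (ω p : ℝ) : ℂ :=
  Complex.I / (2 * ω) + ((corr ω 0 0 - Real.log Real.pi / Real.pi : ℝ) : ℂ)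
    + profile ω |p + p| 0

lemma hasLogConstant_green (hω : 0 < ω) (hωπ : ω < Real.pi) (hp : p < 0) :
    HasLogConstant p (green ω p) (greenConstant ω p) := by
  have hle : 𝓝[strip] ((p, 1) : ℝ × ℝ) ≤ 𝓝 (p, 1) := nhdsWithin_le_nhds
  have h1 := ((isBigO_profile_comp hω hωπ (q := -p) (w := (p, 1))
    (by simp only; linarith)).mono hle).trans (isBigO_sub_dist₁ p _)
  have h2 := ((isBigO_corr_comp hω hωπ p (p, 1)).mono hle).trans (isBigO_sub_dist₁ p _)
  have h3 := isBigO_logPart p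
  have h4 : (fun z : ℝ × ℝ => Complex.I * Complex.exp (Complex.I * ω * (|z.1 - p| : ℝ)) / (2 * ω)
      - Complex.I / (2 * ω)) =O[𝓝[strip] (p, 1)] dist₁ p := by
    -- `|x - p|` is not differentiable at the pole, but the outer function is differentiable at `0`,
    -- and `|x - p| ≤ r`.
    have hd : DifferentiableAt ℝ (fun t : ℝ => Complex.I * Complex.exp (Complex.I * ω * t) / (2 * ω))
        0 := ((hasDerivAt_exp_mul_ofReal (Complex.I * ω) 0).const_mul Complex.I
          |>.div_const (2 * ω : ℂ)).differentiableAt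
    have ht : Tendsto (fun z : ℝ × ℝ => |z.1 - p|) (𝓝[strip] (p, 1)) (𝓝 0) := by
      have hc : Continuous fun z : ℝ × ℝ => |z.1 - p| := by fun_prop
      have := hc.tendsto (p, 1)
      simp only [sub_self, abs_zero] at this
      exact this.mono_left hle
    have hO := hd.isBigO_sub.comp_tendsto ht
    refine (hO.congr_left fun z => by simp).trans ?_
    refine IsBigO.of_bound 1 (Eventually.of_forall fun z => ?_)
    simp only [Function.comp_apply, sub_zero, Real.norm_eq_abs, abs_abs, one_mul]
    exact ((norm_fst_le (z - (p, 1))).trans (norm_sub_le_dist₁ p z)).trans (le_abs_self _)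
  refine (((h4.add h3).add h2).add h1).congr_left fun z => ?_
  simp only [green, greenConstant, profile, sub_neg_eq_add, sub_self, abs_zero]
  push_cast
  ring

/-- The source gives `1/2` and its image `cos(2ωp)/2`; their sum is `cos²(ωp)`. -/
lemma greenConstant_im (hω : 0 < ω) : ((ω : ℂ) * greenConstant ω p).im = Real.cos (ω * p) ^ 2 := by
  rw [Complex.im_ofReal_mul, greenConstant, Complex.add_im, Complex.add_im, Complex.ofReal_im,
    profile_im]
  have e : Complex.I / (2 * ω) = Complex.I / ((2 * ω : ℝ) : ℂ) := by push_cast; rfl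
  have e2 : Real.cos (ω * |p + p|) = 2 * Real.cos (ω * p) ^ 2 - 1 := by
    rw [← Real.cos_two_mul, ← Real.cos_abs (2 * (ω * p)), ← abs_of_pos hω, ← abs_mul,
      abs_of_pos hω]
    congr 2
    ring
  rw [e, Complex.div_ofReal_im, Complex.I_im, e2]
  field_simp
  ring

/-- Source and image give `(cos ω(x - p) + cos ω(x + p)) / (2ω)`; evenness of the cosine removes the
absolute values. -/
lemma green_im (hω : 0 < ω) (z : ℝ × ℝ) :
    (green ω p z).im = Real.cos (ω * p) * Real.cos (ω * z.1) / ω := by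
  have h : ∀ a, Real.cos (ω * |a|) = Real.cos (ω * a) := fun a => by
    rw [← Real.cos_abs (ω * a), abs_mul, abs_of_pos hω]
  rw [green, Complex.add_im, profile_im, profile_im, h, h, mul_sub, mul_add, Real.cos_sub,
    Real.cos_add]
  field_simp
  ring

lemma continuousAt_green (hω : 0 < ω) (hωπ : ω < Real.pi) (hp : p < 0) {z : ℝ × ℝ}
    (hz : z.1 < 0) (h : z.1 ≠ p ∨ z.2 ∈ Ioo (0 : ℝ) 1) : ContinuousAt (green ω p) z := by
  have h1 : logArg |z.1 - p| (1 - z.2) ≠ 0 := by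
    rcases h with h | h
    · exact logArg_ne_zero_of_pos (abs_pos.mpr (sub_ne_zero.mpr h)) _
    · exact logArg_ne_zero_of_mem_Ioo _ ⟨by linarith [h.2], by linarith [h.1]⟩
  have h2 : logArg |z.1 - -p| (1 - z.2) ≠ 0 :=
    logArg_ne_zero_of_pos (abs_pos.mpr (by linarith)) _
  refine (continuousAt_profile_comp hω hωπ p h1).add ?_
  simpa only [sub_neg_eq_add] using continuousAt_profile_comp hω hωπ (-p) h2

/-! ### Identification of the solution with the Green function -/

lemma integral_crossMode_smul_green (hω : 0 < ω) (hωπ : ω < Real.pi) (hp : p < 0) {x : ℝ}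
    (hx : x < 0) (hxp : x ≠ p) (n : ℕ) :
    ∫ y in Ioo (0 : ℝ) 1, crossMode n y • green ω p (x, y) = modeGreen (waveNumber ω n) p x := by
  have h1 : 0 < |x - p| := abs_pos.mpr (sub_ne_zero.mpr hxp)
  have h2 : 0 < |x + p| := abs_pos.mpr (by linarith)
  have hi : ∀ t : ℝ, 0 < t →
      IntegrableOn (fun y => crossMode n y • profile ω t (1 - y)) (Ioo 0 1) := fun t ht =>
    (((continuous_crossMode n).smul (continuous_profile_right hω hωπ ht)).integrableOn_Icc).mono_set
      Ioo_subset_Icc_self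
  simp only [green, smul_add]
  rw [integral_add (hi _ h1) (hi _ h2), integral_crossMode_smul_profile hω hωπ h1,
    integral_crossMode_smul_profile hω hωπ h2, profileCoeff, profileCoeff, modeGreen, add_div]

lemma continuousOn_green (hω : 0 < ω) (hωπ : ω < Real.pi) (hp : p < 0) :
    ContinuousOn (green ω p) strip := fun _ hz =>
  (continuousAt_green hω hωπ hp hz.1 (Or.inr hz.2)).continuousWithinAt

lemma integrableOn_green_slice (hω : 0 < ω) (hωπ : ω < Real.pi) (hp : p < 0) {x : ℝ}
    (hx : x < 0) (hxp : x ≠ p) : IntegrableOn (fun y => green ω p (x, y)) (Ioo 0 1) := by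
  have h2 : x + p ≠ 0 := by linarith
  have hc := (continuous_profile_right hω hωπ (abs_pos.mpr (sub_ne_zero.mpr hxp))).add
    (continuous_profile_right hω hωπ (abs_pos.mpr h2))
  simp only [green]
  exact hc.integrableOn_Icc.mono_set Ioo_subset_Icc_self

/-- On almost every cross-section, an outgoing solution is the Green function. -/
lemma IsPointSourceSolution.ae_eqOn_slice (hω : 0 < ω) (hωπ : ω < Real.pi) (hp : p < 0)
    {γ : ℝ × ℝ → ℂ} (hγ : IsPointSourceSolution ω p γ) {s : ℂ} (hs : HasAmplitude ω γ s) :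
    ∀ᵐ x : ℝ, x < 0 → EqOn (fun y => γ (x, y)) (fun y => green ω p (x, y)) (Ioo 0 1) := by
  filter_upwards [hγ.integrable_slice, ae_all_iff.mpr (hγ.modeCoeff_ae_eq hω hωπ hp hs),
    Measure.ae_ne volume p] with x h1 h2 hxp hx
  have hgx := integrableOn_green_slice hω hωπ hp hx hxp
  have hint : IntegrableOn (fun y => γ (x, y) - green ω p (x, y)) (Ioo 0 1) := (h1 hx).sub hgx
  have hzero := ae_eq_zero_of_integral_crossMode_smul_eq_zero hint fun n => by
    have i1 := integrable_smul_of_bounded (h1 hx) (continuous_crossMode n).aestronglyMeasurable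
      1 (abs_crossMode_le_one n)
    have i2 := integrable_smul_of_bounded hgx (continuous_crossMode n).aestronglyMeasurable
      1 (abs_crossMode_le_one n)
    have h3 := h2 n hx
    rw [modeCoeff, ← integral_crossMode_smul_green hω hωπ hp hx hxp] at h3
    simp only [smul_sub]
    rw [integral_sub i1 i2, h3, sub_self]
  have hmap : MapsTo (fun y : ℝ => (x, y)) (Ioo 0 1) strip := fun y hy => ⟨hx, hy⟩
  have hcont : Continuous fun y : ℝ => (x, y) := by fun_prop
  have hae : (fun y => γ (x, y)) =ᵐ[volume.restrict (Ioo 0 1)] fun y => green ω p (x, y) := by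
    filter_upwards [hzero] with y hy using sub_eq_zero.mp hy
  -- Continuity upgrades equality almost everywhere on the slice to equality everywhere on it.
  exact Measure.eqOn_open_of_ae_eq hae isOpen_Ioo
    (hγ.continuousOn.comp hcont.continuousOn hmap)
    ((continuousOn_green hω hωπ hp).comp hcont.continuousOn hmap)

/-- An outgoing solution is the Green function. -/
theorem IsPointSourceSolution.eqOn_green (hω : 0 < ω) (hωπ : ω < Real.pi) (hp : p < 0)
    {γ : ℝ × ℝ → ℂ} (hγ : IsPointSourceSolution ω p γ) {s : ℂ} (hs : HasAmplitude ω γ s) :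
    EqOn γ (green ω p) strip := by
  rintro ⟨x, y⟩ ⟨hx, hy⟩
  have hmap : MapsTo (fun x : ℝ => (x, y)) (Iio 0) strip := fun x hx => ⟨hx, hy⟩
  have hcont : Continuous fun x : ℝ => (x, y) := by fun_prop
  -- For fixed `y`, equality holds at almost every `x`; continuity in `x` then fills in the
  -- exceptional slices, including `x = p`.
  have hae : (fun x => γ (x, y)) =ᵐ[volume.restrict (Iio 0)] fun x => green ω p (x, y) := by
    rw [EventuallyEq, ae_restrict_iff' measurableSet_Iio]
    filter_upwards [hγ.ae_eqOn_slice hω hωπ hp hs] with x hx hx0 using hx hx0 hy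
  exact Measure.eqOn_open_of_ae_eq hae isOpen_Iio
    (hγ.continuousOn.comp hcont.continuousOn hmap)
    ((continuousOn_green hω hωπ hp).comp hcont.continuousOn hmap) hx

/-! ### Consequences for outgoing solutions -/

lemma hasBoundaryValue_of_eqOn_green (hω : 0 < ω) (hωπ : ω < Real.pi) (hp : p < 0) {q : ℝ}
    (hq : q < 0) (hqp : q ≠ p) {γ : ℝ × ℝ → ℂ} (hγ : EqOn γ (green ω p) strip) :
    HasBoundaryValue q γ (green ω p (q, 1)) :=
  ((continuousAt_green hω hωπ hp (z := (q, 1)) hq (Or.inl hqp)).continuousWithinAt.tendsto).congr'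
    (hγ.symm.eventuallyEq_nhdsWithin)

lemma hasLogConstant_of_eqOn_green (hω : 0 < ω) (hωπ : ω < Real.pi) (hp : p < 0)
    {γ : ℝ × ℝ → ℂ} (hγ : EqOn γ (green ω p) strip) :
    HasLogConstant p γ (greenConstant ω p) := by
  refine (hasLogConstant_green hω hωπ hp).congr' ?_ EventuallyEq.rfl
  filter_upwards [self_mem_nhdsWithin] with z hz
  rw [hγ hz]

/-- Reciprocity: only `|q - p|` and `|q + p|` enter. This makes the two boundary values equal. -/
lemma green_comm (ω p q : ℝ) : green ω p (q, 1) = green ω q (p, 1) := by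
  simp only [green]
  rw [abs_sub_comm, add_comm q p]

lemma im_sub_outgoingMode_eq_zero (hω : 0 < ω) {γ : ℝ × ℝ → ℂ} (hγ : EqOn γ (green ω p) strip)
    {z : ℝ × ℝ} (hz : z ∈ strip) :
    (γ z - Complex.I * Real.cos (ω * p) / ω * outgoingMode ω z).im = 0 := by
  have e : Complex.I * Real.cos (ω * p) / ω * outgoingMode ω z
      = ((Real.cos (ω * p) / ω : ℝ) : ℂ)
        * (Complex.I * Complex.exp (((-(ω * z.1) : ℝ) : ℂ) * Complex.I)) := by
    rw [outgoingMode]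
    push_cast
    ring_nf
  rw [hγ hz, Complex.sub_im, green_im hω, e, Complex.im_ofReal_mul, Complex.I_mul_im,
    Complex.exp_ofReal_mul_I_re, Real.cos_neg]
  ring

lemma IsOutgoingSolution.hasAmplitude_iff (hω : 0 < ω) (hωπ : ω < Real.pi) (hp : p < 0)
    {γ : ℝ × ℝ → ℂ} (hγ : IsOutgoingSolution ω p γ) (s : ℂ) :
    HasAmplitude ω γ s ↔ s = Complex.I * Real.cos (ω * p) / ω := by
  refine ⟨hγ.eq_of_hasAmplitude hω hωπ hp, ?_⟩
  rintro rfl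
  -- Some amplitude exists by hypothesis, and uniqueness forces it to be the stated one; the decay
  -- of `green` need not be examined.
  obtain ⟨s, hs⟩ := hγ.outgoing
  rwa [← hγ.eq_of_hasAmplitude hω hωπ hp hs]

lemma IsOutgoingSolution.eqOn_green (hω : 0 < ω) (hωπ : ω < Real.pi) (hp : p < 0)
    {γ : ℝ × ℝ → ℂ} (hγ : IsOutgoingSolution ω p γ) : EqOn γ (green ω p) strip :=
  let ⟨_, hs⟩ := hγ.outgoing
  hγ.toIsPointSourceSolution.eqOn_green hω hωπ hp hs

end

end HalfStrip

theorem mainTheorem2 (ω p₁ p₂ : ℝ) (hω : 0 < ω) (hωπ : ω < Real.pi)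
    (hp₁ : p₁ < 0) (hp₂ : p₂ < 0) (hne : p₁ ≠ p₂) (γ₁ γ₂ : ℝ × ℝ → ℂ)
    (hγ₁ : HalfStrip.IsOutgoingSolution ω p₁ γ₁)
    (hγ₂ : HalfStrip.IsOutgoingSolution ω p₂ γ₂) :
    (∃ Γt : ℂ, HalfStrip.HasBoundaryValue p₂ γ₁ Γt ∧ HalfStrip.HasBoundaryValue p₁ γ₂ Γt ∧
      ((ω : ℂ) * Γt).im = Real.cos (ω * p₁) * Real.cos (ω * p₂)) ∧
    (∃ Γ₁ : ℂ, HalfStrip.HasLogConstant p₁ γ₁ Γ₁ ∧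
      ((ω : ℂ) * Γ₁).im = Real.cos (ω * p₁) ^ 2) ∧
    (∃ Γ₂ : ℂ, HalfStrip.HasLogConstant p₂ γ₂ Γ₂ ∧
      ((ω : ℂ) * Γ₂).im = Real.cos (ω * p₂) ^ 2) ∧
    (∀ s : ℂ, HalfStrip.HasAmplitude ω γ₁ s ↔ s = Complex.I * Real.cos (ω * p₁) / ω) ∧
    (∀ s : ℂ, HalfStrip.HasAmplitude ω γ₂ s ↔ s = Complex.I * Real.cos (ω * p₂) / ω) ∧
    (∀ z ∈ HalfStrip.strip,
      (γ₁ z - Complex.I * Real.cos (ω * p₁) / ω * HalfStrip.outgoingMode ω z).im = 0) ∧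
    (∀ z ∈ HalfStrip.strip,
      (γ₂ z - Complex.I * Real.cos (ω * p₂) / ω * HalfStrip.outgoingMode ω z).im = 0) := by
  have h₁ := hγ₁.eqOn_green hω hωπ hp₁
  have h₂ := hγ₂.eqOn_green hω hωπ hp₂
  refine ⟨⟨HalfStrip.green ω p₁ (p₂, 1),
      HalfStrip.hasBoundaryValue_of_eqOn_green hω hωπ hp₁ hp₂ hne.symm h₁, ?_, ?_⟩,
    ⟨HalfStrip.greenConstant ω p₁, HalfStrip.hasLogConstant_of_eqOn_green hω hωπ hp₁ h₁,
      HalfStrip.greenConstant_im hω⟩,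
    ⟨HalfStrip.greenConstant ω p₂, HalfStrip.hasLogConstant_of_eqOn_green hω hωπ hp₂ h₂,
      HalfStrip.greenConstant_im hω⟩,
    hγ₁.hasAmplitude_iff hω hωπ hp₁, hγ₂.hasAmplitude_iff hω hωπ hp₂,
    fun z hz => HalfStrip.im_sub_outgoingMode_eq_zero hω h₁ hz,
    fun z hz => HalfStrip.im_sub_outgoingMode_eq_zero hω h₂ hz⟩
  · rw [HalfStrip.green_comm]
    exact HalfStrip.hasBoundaryValue_of_eqOn_green hω hωπ hp₂ hp₁ hne h₂
  · rw [Complex.im_ofReal_mul, HalfStrip.green_im hω, mul_div_cancel₀ _ hω.ne']
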